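/- Let $\mathcal X$ be a quantum set, i.e. a set $\mathrm{At}(\mathcal X)$ of nonzero finite-dimensional complex Hilbert spaces (its atoms). Let $\mathcal X^*$ be its dual, with atoms $X^*=L(X,\mathbb C)$, and let $\ell^\infty(\mathcal X)=\bigoplus_{X}L(X)$ be the associated von Neumann algebra, represented on the $\ell^2$-direct sum $\mathcal H=\bigoplus \mathrm{At}(\mathcal X)$ with inclusion isometries $\mathrm{inc}_X\colon X\to\mathcal H$. A quantum preorder on a von Neumann algebra $M\subseteq L(\mathcal H)$ is an ultraweakly closed algebra $V\subseteq L(\mathcal H)$ with $M'\subseteq V$; it is a quantum partial order if moreover $V\cap V^\dagger\subseteq M'$. A binary relation $R$ on $\mathcal X$ is a choice of subspaces $R(X_1,X_2)\subseteq L(X_1,X_2)$ for all $X_1,X_2\in\mathrm{At}(\mathcal X)$. A relation $P$ of arity $(\mathcal X_1,\dots,\mathcal X_n)$ is a choice of subspaces $P(X_1\otimes\cdots\otimes X_n)\subseteq L(X_1\otimes\cdots\otimes X_n,\mathbb C)$ for all atoms $X_i\in\mathrm{At}(\mathcal X_i)$; its conjugate $P_*$, of arity $(\mathcal X_1^*,\dots,\mathcal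 X_n^*)$, consists of the functionals $\eta\mapsto\langle\xi\,|\,\eta\rangle$ for $\xi\in P(X_1\otimes\cdots\otimes X_n)$. The equality relation $E_{\mathcal X}$, of arity $(\mathcal X,\mathcal X^*)$, is spanned by the evaluation functional on $X\otimes X^*$ for each atom $X$, and vanishes on $X_1\otimes X_2^*$ for distinct atoms. For a binary relation $R$ on $\mathcal X$, $[R]=E_{\mathcal X}\circ(R\times I_{\mathcal X^*})$ is the relation of arity $(\mathcal X,\mathcal X^*)$ consisting of the functionals $x\otimes\varphi\mapsto\varphi(rx)$ for $r\in R(X_1,X_2)$, and $[R]_*$ is its conjugate, regarded as a relation of arity $(\mathcal X^*,\mathcal X)$ via $\mathcal X^{**}=\mathcal X$. Formulas over quantum sets, whose relation symbols are the relations themselves, are interpreted in a context $(x_1,\dots,x_n)\in\mathcal X_1\times\cdots\times\mathcal X_n$ as relations of arity $(\mathcal X_1,\dots,\mathcal X_n)$: an atomic formula $P(x_{i_1},\dots,x_{i_m})$ with distinct variables is interpreted as $P$ times the maximal predicates in the remaining variables, with tensor factors permuted accordingly; $\neg$ and $\wedge$ are the atomwise orthocomplement and intersection; $\llbracket(\forall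 x_1\in\mathcal X_1)\,\phi\rrbracket$ is the largest relation $Q$ of arity $(\mathcal X_2,\dots,\mathcal X_n)$ with $\top_{\mathcal X_1}\times Q\le\llbracket\phi\rrbracket$. Further, $\phi\vee\psi$ abbreviates $\neg(\neg\phi\wedge\neg\psi)$, $\phi\to\psi$ abbreviates $\neg\phi\vee(\phi\wedge\psi)$, and $(\forall(x=x_*)\in\mathcal X\times\mathcal X^*)\,\phi$ abbreviates $(\forall x_*\in\mathcal X^*)(\forall x\in\mathcal X)(E_{\mathcal X}(x,x_*)\to\phi)$. A sentence is true if its interpretation is the maximal relation $\top$ of arity $()$. **Statement.** The assignment $V\mapsto R$, $R(X_1,X_2)=\mathrm{inc}_{X_2}^\dagger\cdot V\cdot\mathrm{inc}_{X_1}$, is a one-to-one correspondence between the quantum preorders $V$ on $\ell^\infty(\mathcal X)$ and the binary relations $R$ on $\mathcal X$ such that the following sentences are true: 1. $(\forall(x=x_*)\in\mathcal X\times\mathcal X^*)\;[R](x,x_*)$; 2. $(\forall(x_1=x_{1*})\in\mathcal X\times\mathcal X^*)(\forall(x_2=x_{2*})\in\mathcal X\times\mathcal X^*)(\forall(x_3=x_{3*})\in\mathcal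 X\times\mathcal X^*)\,\big(([R](x_1,x_{2*})\wedge[R](x_2,x_{3*}))\to[R]_*(x_{1*},x_3)\big)$. It restricts to a one-to-one correspondence between the quantum partial orders $V$ on $\ell^\infty(\mathcal X)$ and the binary relations $R$ on $\mathcal X$ such that (1), (2) and the following sentence are true: 3. $(\forall x_1\in\mathcal X)(\forall x_{2*}\in\mathcal X^*)\,\big(([R](x_1,x_{2*})\wedge[R]_*(x_{2*},x_1))\to E_{\mathcal X}(x_1,x_{2*})\big)$. -/

import Mathlib

open scoped InnerProductSpace ComplexConjugate Topology

universe u v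

noncomputable section

/-! ### Quantum sets -/

/-- The Hilbert space dual `H^* = L(H, ℂ)`: the operator norm of functionals comes from the inner
product transported along the (conjugate-linear, isometric) Riesz isomorphism. -/
@[reducible] def dualInnerProductSpace (H : Type v) [NormedAddCommGroup H]
    [InnerProductSpace ℂ H] [CompleteSpace H] : InnerProductSpace ℂ (StrongDual ℂ H) where
  inner φ ψ :=
    inner ℂ ((InnerProductSpace.toDual ℂ H).symm ψ) ((InnerProductSpace.toDual ℂ H).symm φ)
  norm_sq_eq_re_inner φ := by
    rw [← (InnerProductSpace.toDual ℂ H).symm.norm_map φ]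
    exact norm_sq_eq_re_inner (𝕜 := ℂ) _
  conj_inner_symm φ ψ := inner_conj_symm _ _
  add_left φ ψ χ := by rw [map_add, inner_add_right]
  smul_left φ ψ c := by rw [LinearIsometryEquiv.map_smulₛₗ, inner_smul_right]

/-- A quantum set: a set of nonzero finite-dimensional complex Hilbert spaces, its atoms.
`At` is the set of (labels of) atoms, and distinct labels are distinct atoms. -/
structure QuantumSet where
  At : Type u
  H : At → Type v
  [normed : ∀ a, NormedAddCommGroup (H a)]
  [hilbert : ∀ a, InnerProductSpace ℂ (H a)]
  [finDim : ∀ a, FiniteDimensional ℂ (H a)]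
  [nonzero : ∀ a, Nontrivial (H a)]

attribute [instance] QuantumSet.normed QuantumSet.hilbert QuantumSet.finDim QuantumSet.nonzero

namespace QuantumSet

instance complete (X : QuantumSet.{u, v}) (a : X.At) : CompleteSpace (X.H a) :=
  FiniteDimensional.complete ℂ _

/-- The dual quantum set `X^*`, whose atoms are the duals of the atoms of `X`. -/
abbrev dual (X : QuantumSet.{u, v}) : QuantumSet.{u, v} where
  At := X.At
  H a := StrongDual ℂ (X.H a)
  normed _ := inferInstance
  hilbert a := dualInnerProductSpace (X.H a)
  finDim _ := inferInstance
  nonzero a := (InnerProductSpace.toDual ℂ (X.H a)).toEquiv.symm.nontrivial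

/-! ### Relations on quantum sets -/

/-- The space `L(⨂ i, X i, ℂ)` of functionals on the tensor product of the atoms `a i` of the
quantum sets `𝒳 i`, i.e. the multilinear functionals on these atoms. -/
abbrev Functional {ι : Type} (𝒳 : ι → QuantumSet.{u, v}) (a : ∀ i, (𝒳 i).At) : Type v :=
  MultilinearMap ℂ (fun i => (𝒳 i).H (a i)) ℂ

/-- Predicates on `X`. -/
abbrev Pred (X : QuantumSet.{u, v}) : Type (max u v) :=
  ∀ a : X.At, Submodule ℂ (StrongDual ℂ (X.H a))

/-- Relations of arity `(𝒳 i)_i`: predicates on the Cartesian product of the `𝒳 i`. They carry the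
atomwise order and lattice operations. -/
abbrev Rel {ι : Type} (𝒳 : ι → QuantumSet.{u, v}) : Type (max u v) :=
  ∀ a : ∀ i, (𝒳 i).At, Submodule ℂ (Functional 𝒳 a)

/-- The inner product on `L(⨂ i, X i, ℂ)`. It is computed in an orthonormal basis of `⨂ i, X i`
consisting of elementary tensors, and it does not depend on that basis. -/
def innerFunctional {n : ℕ} {𝒳 : Fin n → QuantumSet.{u, v}} {a : ∀ i, (𝒳 i).At}
    (ξ ζ : Functional 𝒳 a) : ℂ :=
  ∑ k : ∀ i, Fin (Module.finrank ℂ ((𝒳 i).H (a i))),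
    conj (ξ fun i => stdOrthonormalBasis ℂ ((𝒳 i).H (a i)) (k i)) *
      ζ fun i => stdOrthonormalBasis ℂ ((𝒳 i).H (a i)) (k i)

/-- The orthocomplement `¬ R`, computed atomwise. -/
def Rel.neg {n : ℕ} {𝒳 : Fin n → QuantumSet.{u, v}} (R : Rel 𝒳) : Rel 𝒳 := fun a =>
  { carrier := {ζ | ∀ ξ ∈ R a, innerFunctional ξ ζ = 0}
    zero_mem' := fun ξ _ => by simp [innerFunctional]
    add_mem' := fun {ζ ζ'} h h' ξ hξ => by
      have e : innerFunctional ξ (ζ + ζ') = innerFunctional ξ ζ + innerFunctional ξ ζ' := by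
        simp [innerFunctional, mul_add, Finset.sum_add_distrib]
      rw [e, h ξ hξ, h' ξ hξ, add_zero]
    smul_mem' := fun c ζ h ξ hξ => by
      have e : innerFunctional ξ (c • ζ) = c * innerFunctional ξ ζ := by
        simp [innerFunctional, Finset.mul_sum, mul_left_comm]
      rw [e, h ξ hξ, mul_zero] }

/-- The Cartesian product `P × R` of a predicate `P` on `𝒵 0` and a relation `R` of arity
`(𝒵 1, …, 𝒵 n)`. -/
def Rel.consProd {n : ℕ} {𝒵 : Fin (n + 1) → QuantumSet.{u, v}} (P : Pred (𝒵 0))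
    (R : Rel fun i : Fin n => 𝒵 i.succ) : Rel 𝒵 := fun a =>
  Submodule.span ℂ {ζ | ∃ ξ ∈ P (a 0), ∃ η ∈ R fun i => a i.succ,
    ∀ v, ζ v = ξ (v 0) * η fun i => v i.succ}

/-- The functional `η₁ ⊗ ⋯ ⊗ ηₙ`, as an element of `L(⨂ i, X i, ℂ)`. -/
def prodFunctional {n : ℕ} {𝒳 : Fin n → QuantumSet.{u, v}} {a : ∀ i, (𝒳 i).At}
    (η : ∀ i, (𝒳 i).dual.H (a i)) : Functional 𝒳 a :=
  (MultilinearMap.mkPiAlgebra ℂ (Fin n) ℂ).compLinearMap fun i =>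
    (η i : (𝒳 i).H (a i) →L[ℂ] ℂ).toLinearMap

/-- The conjugate `R_*`, of arity `(𝒳 i ^*)_i`. It consists of the functionals `ξ_*` for `ξ` in `R`,
where `ξ_*(η) = ⟨ξ | η⟩` for `η` in the dual of `⨂ i, X i`. -/
def Rel.conjugate {n : ℕ} {𝒳 : Fin n → QuantumSet.{u, v}} (R : Rel 𝒳) :
    Rel fun i => (𝒳 i).dual := fun a =>
  { carrier := {ζ | ∃ ξ ∈ R a, ∀ η, ζ η = innerFunctional ξ (prodFunctional η)}
    zero_mem' := ⟨0, zero_mem _, fun η => by simp [innerFunctional]⟩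
    add_mem' := by
      rintro ζ ζ' ⟨ξ, h, e⟩ ⟨ξ', h', e'⟩
      refine ⟨ξ + ξ', add_mem h h', fun η => ?_⟩
      rw [add_apply, e, e']
      simp [innerFunctional, add_mul, Finset.sum_add_distrib]
    smul_mem' := by
      rintro c ζ ⟨ξ, h, e⟩
      refine ⟨conj c • ξ, Submodule.smul_mem _ _ h, fun η => ?_⟩
      rw [smul_apply, e]
      simp [innerFunctional, Finset.mul_sum, mul_assoc] }

/-! ### Binary relations and their bending -/

/-- Binary relations from `X` to `Y`. -/
abbrev BinRel (X Y : QuantumSet.{u, v}) : Type (max u v) :=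
  ∀ (a : X.At) (b : Y.At), Submodule ℂ (X.H a →L[ℂ] Y.H b)

/-- The components of the evaluation `(x, φ) ↦ φ x` on `X × X^*`: they vanish on pairs of distinct
atoms. -/
def evalPair (X : QuantumSet.{u, v}) (a b : X.At) (x : X.H a) (φ : StrongDual ℂ (X.H b)) : ℂ :=
  open Classical in if h : a = b then φ (h ▸ x) else 0

/-- The equality relation `E_X`, of arity `(X, X^*)`: it is spanned by the evaluation on `X ⊗ X^*`
for each atom `X`, and it is zero for distinct atoms. -/
def eqRel (X : QuantumSet.{u, v}) : Rel ![X, X.dual] := fun a =>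
  { carrier := {ζ | ∃ c : ℂ, ∀ v, ζ v = c * evalPair X (a 0) (a 1) (v 0) (v 1)}
    zero_mem' := ⟨0, fun v => by simp⟩
    add_mem' := by
      rintro ζ ζ' ⟨c, h⟩ ⟨c', h'⟩
      exact ⟨c + c', fun v => by rw [add_apply, h, h', add_mul]⟩
    smul_mem' := by
      rintro d ζ ⟨c, h⟩
      exact ⟨d * c, fun v => by rw [smul_apply, h, smul_eq_mul, mul_assoc]⟩ }

/-- The relation `E_Y ∘ (R × I_{Y^*})` of arity `(X, Y^*)` obtained by bending the outgoing wire of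
a binary relation `R` from `X` to `Y`. Its functionals are `(x, φ) ↦ φ (r x)`, for `r` in `R`. -/
def bend {X Y : QuantumSet.{u, v}} (R : BinRel X Y) : Rel ![X, Y.dual] := fun a =>
  let p : X.At := a 0
  let q : Y.At := a 1
  { carrier := {ζ | ∃ r ∈ R p q, ∀ w, let φ : StrongDual ℂ (Y.H q) := w 1; ζ w = φ (r (w 0))}
    zero_mem' := ⟨0, zero_mem _, fun w => by
      let φ : StrongDual ℂ (Y.H q) := w 1
      exact (map_zero φ).symm⟩
    add_mem' := by
      rintro ζ ζ' ⟨r, h, e⟩ ⟨r', h', e'⟩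
      refine ⟨r + r', add_mem h h', fun w => ?_⟩
      let φ : StrongDual ℂ (Y.H q) := w 1
      rw [add_apply, e, e']
      exact (map_add φ _ _).symm
    smul_mem' := by
      rintro c ζ ⟨r, h, e⟩
      refine ⟨c • r, Submodule.smul_mem _ _ h, fun w => ?_⟩
      let φ : StrongDual ℂ (Y.H q) := w 1
      rw [smul_apply, e]
      exact (map_smul φ _ _).symm }

/-- The conjugate `(bend R)_*`, of arity `(X^*, Y)`, where `Y^{**}` is identified with `Y` in the
canonical way. -/
def bendConj {X Y : QuantumSet.{u, v}} (R : BinRel X Y) : Rel ![X.dual, Y] := fun a =>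
  let p : X.At := a 0
  let q : Y.At := a 1
  { carrier := {ζ | ∃ θ ∈ (bend R).conjugate (Fin.cons p (Fin.cons q finZeroElim)),
      ∀ w, ζ w = θ (Fin.cons (w 0)
        (Fin.cons (NormedSpace.inclusionInDoubleDual ℂ (Y.H q) (w 1)) finZeroElim))}
    zero_mem' := ⟨0, zero_mem _, fun w => rfl⟩
    add_mem' := by
      rintro ζ ζ' ⟨r, h, e⟩ ⟨r', h', e'⟩
      exact ⟨r + r', add_mem h h', fun w => by rw [add_apply, e, e', add_apply]⟩
    smul_mem' := by
      rintro c ζ ⟨r, h, e⟩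
      exact ⟨c • r, Submodule.smul_mem _ _ h, fun w => by rw [smul_apply, e, smul_apply]⟩ }

/-! ### Primitive formulas and their interpretation -/

/-- A variable of sort `Y` in the context `x₀ ∈ 𝒳 0, …, xₙ₋₁ ∈ 𝒳 (n - 1)`. -/
structure Var {n : ℕ} (𝒳 : Fin n → QuantumSet.{u, v}) (Y : QuantumSet.{u, v}) where
  idx : Fin n
  sort : 𝒳 idx = Y

/-- The atom of `Y` over which a variable of sort `Y` ranges, given the atoms of the context. -/
def Var.atom {n : ℕ} {𝒳 : Fin n → QuantumSet.{u, v}} {Y : QuantumSet.{u, v}} (x : Var 𝒳 Y)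
    (a : ∀ i, (𝒳 i).At) : Y.At :=
  cast (congrArg QuantumSet.At x.sort) (a x.idx)

/-- The vector in the place of a variable, given the vectors in the places of the context. -/
def Var.vec {n : ℕ} {𝒳 : Fin n → QuantumSet.{u, v}} {Y : QuantumSet.{u, v}} (x : Var 𝒳 Y)
    (a : ∀ i, (𝒳 i).At) (w : ∀ i, (𝒳 i).H (a i)) : Y.H (x.atom a) :=
  match Y, x with
  | _, ⟨i, rfl⟩ => w i

/-- Primitive formulas whose free variables are among `x₀ ∈ 𝒳 0, …, xₙ₋₁ ∈ 𝒳 (n - 1)`. The relation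
symbols are the relations themselves, and the arguments of a relation symbol are distinct variables.
A quantifier binds the variable `x₀` of the extended context of its scope. -/
inductive Formula : {n : ℕ} → (Fin n → QuantumSet.{u, v}) → Type (max (u + 1) (v + 1))
  | atomic {n m : ℕ} {𝒳 : Fin n → QuantumSet.{u, v}} {𝒴 : Fin m → QuantumSet.{u, v}}
      (R : Rel 𝒴) (x : ∀ k, Var 𝒳 (𝒴 k)) (distinct : Function.Injective fun k => (x k).idx) :
      Formula 𝒳
  | neg {n : ℕ} {𝒳 : Fin n → QuantumSet.{u, v}} (φ : Formula 𝒳) : Formula 𝒳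
  | and {n : ℕ} {𝒳 : Fin n → QuantumSet.{u, v}} (φ ψ : Formula 𝒳) : Formula 𝒳
  | all {n : ℕ} {𝒳 : Fin n → QuantumSet.{u, v}} (X : QuantumSet.{u, v})
      (φ : Formula (Matrix.vecCons X 𝒳)) : Formula 𝒳

/-- The interpretation of an atomic formula: the product of `R` with the maximal predicates for the
variables of the context that are not arguments, its tensor factors permuted into the order of the
context. It is spanned by the products of a functional from `R` in the arguments and an arbitrary
functional in the remaining variables. -/
def interpAtomic {n m : ℕ} {𝒳 : Fin n → QuantumSet.{u, v}} {𝒴 : Fin m → QuantumSet.{u, v}}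
    (R : Rel 𝒴) (x : ∀ k, Var 𝒳 (𝒴 k)) : Rel 𝒳 := fun a =>
  Submodule.span ℂ {ζ | ∃ ξ ∈ R fun k => (x k).atom a,
    ∃ η : Functional (fun j : {j : Fin n // ∀ k, (x k).idx ≠ j} => 𝒳 j) (fun j => a j),
      ∀ w, ζ w = ξ (fun k => (x k).vec a w) * η fun j => w j}

/-- The interpretation of a primitive formula in its context. -/
def Formula.interp : {n : ℕ} → {𝒳 : Fin n → QuantumSet.{u, v}} → Formula 𝒳 → Rel 𝒳
  | _, _, atomic R x _ => interpAtomic R x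
  | _, _, neg φ => Rel.neg φ.interp
  | _, _, and φ ψ => φ.interp ⊓ ψ.interp
  | _, 𝒳, all X φ =>
      sSup {R : Rel 𝒳 | Rel.consProd (𝒵 := Matrix.vecCons X 𝒳) (⊤ : Pred X) R ≤ φ.interp}

namespace Formula

variable {n : ℕ} {𝒳 : Fin n → QuantumSet.{u, v}}

/-- The interpretation of a sentence is a relation of arity `()`; the sentence is true if that
relation is the maximal one. -/
def IsTrue (φ : Formula (![] : Fin 0 → QuantumSet.{u, v})) : Prop :=
  φ.interp = ⊤

/-- Disjunction. -/
def or (φ ψ : Formula 𝒳) : Formula 𝒳 := neg (and (neg φ) (neg ψ))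

/-- Implication, the Sasaki arrow. -/
def imp (φ ψ : Formula 𝒳) : Formula 𝒳 := or (neg φ) (and φ ψ)

/-- The atomic formula `R(xᵢ, xⱼ)`, for a binary relation symbol `R`. -/
def atomic₂ {X Y : QuantumSet.{u, v}} (R : Rel ![X, Y]) (i j : Fin n) (hi : 𝒳 i = X)
    (hj : 𝒳 j = Y) (hij : i ≠ j) : Formula 𝒳 :=
  atomic R (Fin.cons ⟨i, hi⟩ (Fin.cons ⟨j, hj⟩ finZeroElim))
    (fun k l => by
      fin_cases k <;> fin_cases l <;> first | exact fun _ => rfl | exact fun h => absurd h hij |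
        exact fun h => absurd h.symm hij)

/-- The diagonal quantifier `(∀ (x = x_*) ∈ X × X^*) φ`, an abbreviation for
`(∀ x_* ∈ X^*) (∀ x ∈ X) (E_X(x, x_*) → φ)`. In the context of `φ`, the variable `x` has index `0`
and the variable `x_*` has index `1`. -/
def allDiag (X : QuantumSet.{u, v}) (φ : Formula (Matrix.vecCons X (Matrix.vecCons X.dual 𝒳))) :
    Formula 𝒳 :=
  all X.dual (all X (imp (atomic₂ (eqRel X) 0 1 rfl rfl (by simp)) φ))

end Formula

open Formula

variable {X : QuantumSet.{u, v}}

/-- `(∀ (x = x_*) ∈ X × X^*) [R](x, x_*)`. -/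
def reflexivity (R : BinRel X X) : Formula (![] : Fin 0 → QuantumSet.{u, v}) :=
  allDiag X (atomic₂ (bend R) 0 1 rfl rfl (by decide))

/-- `(∀ (x₁ = x₁_*)) (∀ (x₂ = x₂_*)) (∀ (x₃ = x₃_*))
  (([R](x₁, x₂_*) ∧ [R](x₂, x₃_*)) → [R]_*(x₁_*, x₃))`.
In the innermost context, `x₃, x₃_*, x₂, x₂_*, x₁, x₁_*` have the indices `0, 1, 2, 3, 4, 5`. -/
def transitivity (R : BinRel X X) : Formula (![] : Fin 0 → QuantumSet.{u, v}) :=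
  allDiag X (allDiag X (allDiag X
    (imp
      (and (atomic₂ (bend R) 4 3 rfl rfl (by decide)) (atomic₂ (bend R) 2 1 rfl rfl (by decide)))
      (atomic₂ (bendConj R) 5 0 rfl rfl (by decide)))))

/-- `(∀ x₁ ∈ X) (∀ x₂_* ∈ X^*) (([R](x₁, x₂_*) ∧ [R]_*(x₂_*, x₁)) → E_X(x₁, x₂_*))`.
In the innermost context, `x₂_*, x₁` have the indices `0, 1`. -/
def antisymmetry (R : BinRel X X) : Formula (![] : Fin 0 → QuantumSet.{u, v}) :=
  all X (all X.dual
    (imp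
      (and (atomic₂ (bend R) 1 0 rfl rfl (by decide))
        (atomic₂ (bendConj R) 0 1 rfl rfl (by decide)))
      (atomic₂ (eqRel X) 1 0 rfl rfl (by decide))))

end QuantumSet

/-! ### Weaver's quantum preorders and quantum partial orders -/

section Weaver

variable {H : Type*} [NormedAddCommGroup H] [InnerProductSpace ℂ H]

/-- The ultraweak topology on `L(H)`: the coarsest topology for which all the functionals
`T ↦ ∑ k, ⟨x k | T (y k)⟩`, with `x` and `y` square-summable sequences in `H`, are continuous. -/
@[reducible] def ultraweakTopology (H : Type*) [NormedAddCommGroup H] [InnerProductSpace ℂ H] :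
    TopologicalSpace (H →L[ℂ] H) :=
  ⨅ (x : lp (fun _ : ℕ => H) 2) (y : lp (fun _ : ℕ => H) 2),
    TopologicalSpace.induced (fun T : H →L[ℂ] H => ∑' k, inner ℂ (x k) (T (y k))) inferInstance

variable [CompleteSpace H]

/-- A quantum preorder on a von Neumann algebra `M ⊆ L(H)`: an ultraweakly closed algebra of
operators on `H` that contains the commutant of `M`. -/
structure IsQuantumPreorder (M : VonNeumannAlgebra H) (V : Submodule ℂ (H →L[ℂ] H)) : Prop where
  isClosed : IsClosed[ultraweakTopology H] (V : Set (H →L[ℂ] H))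
  mul_mem : ∀ S ∈ V, ∀ T ∈ V, S * T ∈ V
  commutant_subset : ∀ T ∈ M.commutant, T ∈ V

/-- A quantum partial order on `M`: a quantum preorder `V` that is antisymmetric, in the sense that
`V ∩ V^† ⊆ M'`. -/
structure IsQuantumPartialOrder (M : VonNeumannAlgebra H) (V : Submodule ℂ (H →L[ℂ] H)) : Prop
    extends IsQuantumPreorder M V where
  antisymm : ∀ T ∈ V, star T ∈ V → T ∈ M.commutant

end Weaver

namespace QuantumSet

variable (X : QuantumSet.{u, v})

/-- The `ℓ²`-direct sum of the atoms of `X`. -/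
abbrev directSum : Type (max u v) := lp X.H 2

/-- The inclusion isometry of an atom into the direct sum of all atoms. -/
def inc (a : X.At) : X.H a →L[ℂ] X.directSum :=
  open Classical in
  { toLinearMap := lp.lsingle (𝕜 := ℂ) (E := X.H) 2 a
    cont := (lp.isometry_single (E := X.H) (p := 2) a).continuous }

theorem adjoint_inc (a : X.At) (f : X.directSum) :
    ContinuousLinearMap.adjoint (X.inc a) f = f a := by
  classical
  refine ext_inner_left ℂ fun y => ?_
  rw [ContinuousLinearMap.adjoint_inner_right]
  refine Eq.trans ?_ (lp.inner_single_left (𝕜 := ℂ) a y f)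
  congr!

/-- The von Neumann algebra `ℓ^∞(X)`, the `ℓ^∞`-direct sum of the algebras `L(X)` over the atoms,
in its canonical representation: the bounded operators `T` on the direct sum of the atoms that act on
each atom separately, by operators `t a` (which automatically satisfy `‖t a‖ ≤ ‖T‖`). -/
def ellInfty : VonNeumannAlgebra X.directSum where
  carrier := {T | ∃ t : ∀ a, X.H a →L[ℂ] X.H a, ∀ f a, T f a = t a (f a)}
  mul_mem' := by
    rintro S T ⟨s, hs⟩ ⟨t, ht⟩
    exact ⟨fun a => s a * t a, fun f a => by simp [hs, ht]⟩
  add_mem' := by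
    rintro S T ⟨s, hs⟩ ⟨t, ht⟩
    exact ⟨fun a => s a + t a, fun f a => by simp [hs, ht]⟩
  algebraMap_mem' c := ⟨fun a => algebraMap ℂ _ c, fun f a => by
    simp [Algebra.algebraMap_eq_smul_one]⟩
  star_mem' := by
    rintro T ⟨t, ht⟩
    classical
    refine ⟨fun a => star (t a), fun f a => ext_inner_left ℂ fun y => ?_⟩
    have e : T (lp.single 2 a y) = lp.single 2 a (t a y) := by
      ext b
      rw [ht]
      rcases eq_or_ne b a with rfl | h
      · simp
      · simp [h]
    rw [← lp.inner_single_left (𝕜 := ℂ) a y (star T f), ContinuousLinearMap.star_eq_adjoint,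
      ContinuousLinearMap.adjoint_inner_right, e, lp.inner_single_left]
    exact (ContinuousLinearMap.adjoint_inner_right (t a) y (f a)).symm
  centralizer_centralizer' := by
    refine Set.Subset.antisymm (fun T hT => ?_) Set.subset_centralizer_centralizer
    have hinc : ∀ a (y : X.H a), ContinuousLinearMap.adjoint (X.inc a) (X.inc a y) = y :=
      fun a y => by
        classical
        rw [adjoint_inc]
        exact lp.single_apply_self (E := X.H) 2 a y
    refine ⟨fun a => ContinuousLinearMap.adjoint (X.inc a) ∘L T ∘L X.inc a, fun f a => ?_⟩
    have hp : X.inc a ∘L ContinuousLinearMap.adjoint (X.inc a) ∈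
        Set.centralizer {T : X.directSum →L[ℂ] X.directSum |
          ∃ t : ∀ a, X.H a →L[ℂ] X.H a, ∀ f a, T f a = t a (f a)} := by
      rintro S ⟨s, hs⟩
      ext f b
      classical
      have hval : ∀ g : X.H a, (X.inc a g : X.directSum) b = Pi.single (M := X.H) a g b :=
        fun g => by simp [inc, lp.lsingle]; congr!
      simp only [mul_apply_eq_comp, ContinuousLinearMap.comp_apply, hs, adjoint_inc,
        hval]
      rcases eq_or_ne b a with rfl | h
      · simp
      · simp [h]
    have hc := congrArg (fun S : X.directSum →L[ℂ] X.directSum => S f a) (hT _ hp)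
    simp only [mul_apply_eq_comp, ContinuousLinearMap.comp_apply] at hc
    rw [← adjoint_inc, hinc, adjoint_inc, adjoint_inc] at hc
    simp only [ContinuousLinearMap.comp_apply, adjoint_inc]
    exact hc

/-- The binary relation on `X` associated to a subspace `V` of operators on the direct sum of the
atoms: `R(X₁, X₂) = inc_{X₂}^† V inc_{X₁}`. -/
def relOf (V : Submodule ℂ (X.directSum →L[ℂ] X.directSum)) : BinRel X X := fun a b =>
  { carrier := {r | ∃ T ∈ V, r = ContinuousLinearMap.adjoint (X.inc b) ∘L T ∘L X.inc a}
    zero_mem' := ⟨0, zero_mem _, by simp⟩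
    add_mem' := by
      rintro r r' ⟨T, h, rfl⟩ ⟨T', h', rfl⟩
      exact ⟨T + T', add_mem h h', by ext; simp⟩
    smul_mem' := by
      rintro c r ⟨T, h, rfl⟩
      exact ⟨c • T, Submodule.smul_mem _ _ h, by ext; simp⟩ }

end QuantumSet

end

/-! Both sides of the correspondence reduce to the same conditions on the blocks of operators: the
spaces R(b, c) contain the identities and are closed under composition, and for partial orders, r in
R(b, c) with adjoint in R(c, b) is scalar (zero if b ≠ c).

Operators. The commutant of ℓ^∞(X) consists of the block-diagonal operators that are scalar on each
atom. It contains the projections onto atoms, so a quantum preorder V contains every block of its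
elements, seen as an operator on the direct sum. Each T is the ultraweak limit of its compressions
to finitely many atoms, which are finite sums of blocks; hence T is in V iff all its blocks are in R
(`IsQuantumPreorder.mem_iff`), and V is determined by R. Conversely, the operators with all blocks
in R form an ultraweakly closed space (`isClosed_opsOf`), since each block lives in a
finite-dimensional space, and an algebra if R is closed under composition (`mul_mem_opsOf`).

Formulas. The Sasaki arrow φ → ψ contains ζ iff the orthogonal projection of ζ onto φ lies in ψ
(`mem_imp_iff`). The projection of a pure tensor onto the equality relation is a multiple of the
evaluation E, so a diagonal quantifier amounts to tensoring with E on each atom (`mem_allDiag_iff`).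
Reflexivity then says that E, whose operator is the identity, lies in [R]. Antisymmetry is an
inclusion between relations on two variables.

Transitivity says that the projection π of E ⊗ E ⊗ E onto the premise lies in [R]_*. The two atoms
of the premise have disjoint variables, so π is governed by its contractions with pairs (r, s) from
R. Contracting E ⊗ E ⊗ E with (r, s) leaves the functional (φ, y) ↦ φ((s r)^† y) (`contract_evals`),
which is in [R]_* if s r is in R. The slices of π in the remaining variables are such contractions
(`exists_contract_eq`), and conversely the contractions are combinations of slices. -/

noncomputable section

namespace QuantumSet

/-! ### The Hilbert space of functionals -/

section Functionals

variable {n : ℕ} {𝒳 : Fin n → QuantumSet.{u, v}} {a : ∀ i, (𝒳 i).At}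

/-- Indices of the orthonormal basis of elementary tensors of `⨂ i, X i`. -/
abbrev Idx (𝒳 : Fin n → QuantumSet.{u, v}) (a : ∀ i, (𝒳 i).At) : Type :=
  ∀ i, Fin (Module.finrank ℂ ((𝒳 i).H (a i)))

/-- The standard orthonormal basis of an atom. -/
abbrev onb (X : QuantumSet.{u, v}) (b : X.At) :
    OrthonormalBasis (Fin (Module.finrank ℂ (X.H b))) ℂ (X.H b) :=
  stdOrthonormalBasis ℂ (X.H b)

/-- The vectors of an elementary tensor in the orthonormal basis. -/
abbrev basisVec (κ : Idx 𝒳 a) : ∀ i, (𝒳 i).H (a i) := fun i => (𝒳 i).onb (a i) (κ i)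

theorem functional_ext {ξ ζ : Functional 𝒳 a} (h : ∀ κ : Idx 𝒳 a, ξ (basisVec κ) = ζ (basisVec κ)) :
    ξ = ζ :=
  Module.Basis.ext_multilinear (fun i => ((𝒳 i).onb (a i)).toBasis) fun κ => by simpa using h κ

theorem functional_sum_apply {ι : Type*} (s : Finset ι) (f : ι → Functional 𝒳 a)
    (w : ∀ i, (𝒳 i).H (a i)) : (∑ i ∈ s, f i) w = ∑ i ∈ s, f i w :=
  map_sum ({ toFun := fun g => g w, map_zero' := rfl, map_add' := fun _ _ => rfl } :
    Functional 𝒳 a →+ ℂ) f s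

theorem innerFunctional_eq (ξ ζ : Functional 𝒳 a) :
    innerFunctional ξ ζ = ∑ κ : Idx 𝒳 a, conj (ξ (basisVec κ)) * ζ (basisVec κ) := rfl

/-- The inner product of functionals as an inner product space structure. -/
@[reducible] def functionalCore : InnerProductSpace.Core ℂ (Functional 𝒳 a) where
  inner := innerFunctional
  conj_inner_symm ξ ζ := by simp [innerFunctional_eq, mul_comm]
  re_inner_nonneg ξ := by
    rw [innerFunctional_eq, map_sum]
    exact Finset.sum_nonneg fun κ _ => by
      rw [← Complex.normSq_eq_conj_mul_self]
      simpa using Complex.normSq_nonneg _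
  add_left ξ ξ' ζ := by simp [innerFunctional_eq, add_mul, Finset.sum_add_distrib]
  smul_left ξ ζ c := by simp [innerFunctional_eq, Finset.mul_sum, mul_assoc]
  definite ξ h := by
    refine functional_ext fun κ => ?_
    have h' : ∑ κ : Idx 𝒳 a, Complex.normSq (ξ (basisVec κ)) = 0 := by
      have := congrArg Complex.re h
      simpa [innerFunctional_eq, ← Complex.normSq_eq_conj_mul_self] using this
    rw [Finset.sum_eq_zero_iff_of_nonneg fun κ _ => Complex.normSq_nonneg _] at h'
    simpa using h' κ (Finset.mem_univ _)

/-- De Morgan's law turns the unfolded Sasaki arrow into Sᗮ ⊔ (S ⊓ T). The vector `p` is the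
orthogonal projection of `z` onto `S`, so the condition is that this projection lies in `T`. -/
theorem _root_.Submodule.mem_sasaki_iff {F : Type*} [NormedAddCommGroup F] [InnerProductSpace ℂ F]
    [FiniteDimensional ℂ F] (S T : Submodule ℂ F) (z : F) :
    z ∈ (Sᗮᗮ ⊓ (S ⊓ T)ᗮ)ᗮ ↔ ∃ p ∈ S ⊓ T, ∀ s ∈ S, inner ℂ s (z - p) = 0 := by
  have e : (Sᗮᗮ ⊓ (S ⊓ T)ᗮ)ᗮ = Sᗮ ⊔ (S ⊓ T) := by
    rw [Submodule.inf_orthogonal, Submodule.orthogonal_orthogonal]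
  rw [e, Submodule.mem_sup]
  constructor
  · rintro ⟨q, hq, p, hp, rfl⟩
    exact ⟨p, hp, fun s hs => by simpa using hq s hs⟩
  · rintro ⟨p, hp, h⟩
    exact ⟨z - p, h, p, hp, sub_add_cancel _ _⟩

theorem mem_imp_iff (φ ψ : Formula 𝒳) (ζ : Functional 𝒳 a) :
    ζ ∈ (φ.imp ψ).interp a ↔ ∃ π ∈ φ.interp a, π ∈ ψ.interp a ∧
      ∀ θ ∈ φ.interp a, innerFunctional θ (ζ - π) = 0 := by
  -- For this inner product, `Rel.neg` is by definition the orthogonal complement.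
  let _ : NormedAddCommGroup (Functional 𝒳 a) := functionalCore.toNormedAddCommGroup
  let _ : InnerProductSpace ℂ (Functional 𝒳 a) := InnerProductSpace.ofCore functionalCore.toCore
  have := Submodule.mem_sasaki_iff (φ.interp a) (ψ.interp a) ζ
  simp only [Submodule.mem_inf, and_assoc] at this
  exact this

theorem exists_projection (S : Submodule ℂ (Functional 𝒳 a)) (ζ : Functional 𝒳 a) :
    ∃ π ∈ S, ∀ θ ∈ S, innerFunctional θ (ζ - π) = 0 := by
  let _ : NormedAddCommGroup (Functional 𝒳 a) := functionalCore.toNormedAddCommGroup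
  let _ : InnerProductSpace ℂ (Functional 𝒳 a) := InnerProductSpace.ofCore functionalCore.toCore
  obtain ⟨π, hπ, q, hq, e⟩ := Submodule.mem_sup.1
    (show ζ ∈ S ⊔ Sᗮ by rw [Submodule.sup_orthogonal_of_hasOrthogonalProjection]; trivial)
  exact ⟨π, hπ, fun θ hθ => by rw [← e, add_sub_cancel_left]; exact hq θ hθ⟩

theorem eq_of_forall_innerFunctional {S : Submodule ℂ (Functional 𝒳 a)} {π ζ : Functional 𝒳 a}
    (hπ : π ∈ S) (hζ : ζ ∈ S) (h : ∀ θ ∈ S, innerFunctional θ (ζ - π) = 0) : π = ζ :=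
  (sub_eq_zero.1 (functionalCore.definite _ (h _ (S.sub_mem hζ hπ)))).symm

theorem mem_imp_iff_of_mem {φ ψ : Formula 𝒳} {ζ : Functional 𝒳 a} (h : ζ ∈ φ.interp a) :
    ζ ∈ (φ.imp ψ).interp a ↔ ζ ∈ ψ.interp a := by
  rw [mem_imp_iff]
  constructor
  · rintro ⟨π, hπ, hπ', h'⟩
    rwa [← eq_of_forall_innerFunctional hπ h h']
  · exact fun h' => ⟨ζ, h, h', fun θ _ => by simp [innerFunctional_eq]⟩

/-- Elements of φ are their own projections, and every functional has a projection in φ. -/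
theorem imp_interp_eq_top_iff (φ ψ : Formula 𝒳) :
    (φ.imp ψ).interp = ⊤ ↔ φ.interp ≤ ψ.interp := by
  constructor
  · intro h a ζ hζ
    rw [← mem_imp_iff_of_mem hζ, h]
    trivial
  · intro h
    funext a
    refine eq_top_iff.2 fun ζ _ => ?_
    rw [mem_imp_iff]
    obtain ⟨π, hπ, h'⟩ := exists_projection (φ.interp a) ζ
    exact ⟨π, hπ, h a hπ, h'⟩

end Functionals

/-! ### Universal quantifiers -/

section Quantifiers

variable {n : ℕ} {X : QuantumSet.{u, v}} {𝒳 : Fin n → QuantumSet.{u, v}}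

/-- An atom of `X`, followed by a family of atoms. -/
abbrev consAt (b : X.At) (a : ∀ i, (𝒳 i).At) : ∀ i, (Matrix.vecCons X 𝒳 i).At := Fin.cons b a

/-- The functional `ξ ⊗ ζ`. -/
def tensor {b : X.At} {a : ∀ i, (𝒳 i).At} (ξ : StrongDual ℂ (X.H b)) (ζ : Functional 𝒳 a) :
    Functional (Matrix.vecCons X 𝒳) (consAt b a) :=
  LinearMap.uncurryLeft (M := fun i => (Matrix.vecCons X 𝒳 i).H (consAt b a i))
    (LinearMap.smulRight (ξ : X.H b →L[ℂ] ℂ).toLinearMap ζ)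

theorem tensor_zero {b : X.At} {a : ∀ i, (𝒳 i).At} (ξ : StrongDual ℂ (X.H b)) :
    tensor ξ (0 : Functional 𝒳 a) = 0 :=
  MultilinearMap.ext fun _ => mul_zero _

theorem tensor_add {b : X.At} {a : ∀ i, (𝒳 i).At} (ξ : StrongDual ℂ (X.H b))
    (ζ ζ' : Functional 𝒳 a) : tensor ξ (ζ + ζ') = tensor ξ ζ + tensor ξ ζ' :=
  MultilinearMap.ext fun _ => mul_add _ _ _

theorem tensor_smul {b : X.At} {a : ∀ i, (𝒳 i).At} (ξ : StrongDual ℂ (X.H b)) (c : ℂ)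
    (ζ : Functional 𝒳 a) : tensor ξ (c • ζ) = c • tensor ξ ζ :=
  MultilinearMap.ext fun _ => mul_left_comm _ _ _

theorem consProd_le_iff (R : Rel 𝒳) (S : Rel (Matrix.vecCons X 𝒳)) :
    Rel.consProd (𝒵 := Matrix.vecCons X 𝒳) (⊤ : Pred X) R ≤ S ↔
      ∀ a b (ξ : StrongDual ℂ (X.H b)), ∀ ζ ∈ R a, tensor ξ ζ ∈ S (consAt b a) := by
  constructor
  · intro h a b ξ ζ hζ
    exact h _ (Submodule.subset_span ⟨ξ, trivial, ζ, hζ, fun _ => rfl⟩)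
  · intro h a'
    obtain ⟨b, a, rfl⟩ : ∃ b a, a' = consAt b a := ⟨a' 0, Fin.tail a', (Fin.cons_self_tail a').symm⟩
    refine Submodule.span_le.2 ?_
    rintro ζ ⟨ξ, -, η, hη, e⟩
    have : ζ = tensor ξ η := MultilinearMap.ext e
    rw [this]
    exact h a b ξ η hη

theorem mem_all_iff (φ : Formula (Matrix.vecCons X 𝒳)) {a : ∀ i, (𝒳 i).At} (ζ : Functional 𝒳 a) :
    ζ ∈ (Formula.all X φ).interp a ↔
      ∀ (b : X.At) (ξ : StrongDual ℂ (X.H b)), tensor ξ ζ ∈ φ.interp (consAt b a) := by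
  -- The functionals satisfying the right-hand side form subspaces, so `Q` is itself admissible in
  -- the supremum that interprets the quantifier, and it bounds all other candidates.
  let Q : Rel 𝒳 := fun a =>
    { carrier := {ζ | ∀ (b : X.At) (ξ : StrongDual ℂ (X.H b)), tensor ξ ζ ∈ φ.interp (consAt b a)}
      zero_mem' := fun b ξ => by
        rw [tensor_zero]
        exact zero_mem _
      add_mem' := fun {ζ ζ'} h h' b ξ => by
        rw [tensor_add]
        exact add_mem (h b ξ) (h' b ξ)
      smul_mem' := fun c ζ h b ξ => by
        rw [tensor_smul]
        exact Submodule.smul_mem _ c (h b ξ) }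
  have e : (Formula.all X φ).interp = Q := by
    refine le_antisymm (sSup_le fun R hR a ζ hζ b ξ => ?_) (le_sSup ?_)
    · exact (consProd_le_iff R φ.interp).1 hR a b ξ ζ hζ
    · exact (consProd_le_iff Q φ.interp).2 fun a b ξ ζ hζ => hζ b ξ
  rw [e]
  exact Iff.rfl

/-- Pure tensors span, so a subspace containing all of them is everything. -/
theorem all_interp_eq_top_iff (φ : Formula (Matrix.vecCons X 𝒳)) :
    (Formula.all X φ).interp = ⊤ ↔ φ.interp = ⊤ := by
  constructor
  · intro h
    funext a'
    obtain ⟨b, a, rfl⟩ : ∃ b a, a' = consAt b a := ⟨a' 0, Fin.tail a', (Fin.cons_self_tail a').symm⟩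
    refine eq_top_iff.2 fun ζ _ => ?_
    -- Expansion of the first argument in an orthonormal basis.
    have e : ζ = ∑ i, tensor (innerSL ℂ (X.onb b i))
        (MultilinearMap.curryLeft (M := fun i => (Matrix.vecCons X 𝒳 i).H (consAt b a i)) ζ
          (X.onb b i)) := by
      ext w
      let f : X.H b →ₗ[ℂ] Functional 𝒳 a :=
        MultilinearMap.curryLeft (M := fun i => (Matrix.vecCons X 𝒳 i).H (consAt b a i)) ζ
      have h₁ : ζ w = f (w 0) (Fin.tail w) :=
        congrArg ζ (Fin.cons_self_tail w).symm
      have h₂ : ∀ x : X.H b, f x = ∑ i, inner ℂ (X.onb b i) x • f (X.onb b i) := fun x => by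
        conv_lhs => rw [← (X.onb b).sum_repr' x]
        simp only [map_sum, map_smul]
      refine (h₁.trans ?_).trans (functional_sum_apply _ _ _).symm
      exact (congrArg (fun g : Functional 𝒳 a => g (Fin.tail w)) (h₂ (w 0))).trans
        (functional_sum_apply _ _ _)
    rw [e]
    refine Submodule.sum_mem _ fun i _ => ?_
    refine (mem_all_iff φ _).1 ?_ b _
    rw [h]
    trivial
  · intro h
    funext a
    refine eq_top_iff.2 fun ζ _ => (mem_all_iff φ ζ).2 fun b ξ => ?_
    rw [h]
    trivial

end Quantifiers

end QuantumSet

/-- The two factors use complementary sets of variables, and injectivity of `s` lets each variable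
enter `A` at most once, so the product is linear in each variable. -/
theorem MultilinearMap.exists_mul {ι κ : Type*} {M : ι → Type*} [∀ i, AddCommMonoid (M i)]
    [∀ i, Module ℂ (M i)] {s : κ → ι} (hs : Function.Injective s)
    (A : MultilinearMap ℂ (fun k => M (s k)) ℂ)
    (B : MultilinearMap ℂ (fun j : {j // ∀ k, s k ≠ j} => M j) ℂ) :
    ∃ f : MultilinearMap ℂ M ℂ, ∀ w, f w = A (fun k => w (s k)) * B fun j => w j := by
  classical
  have hA : ∀ (w : ∀ i, M i) (k : κ) (y : M (s k)),
      (fun k' => Function.update w (s k) y (s k')) = Function.update (fun k' => w (s k')) k y :=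
    fun w k y => Function.update_comp_eq_of_injective' w hs k y
  have hA' : ∀ (w : ∀ i, M i) (j : {j // ∀ k, s k ≠ j}) (y : M j),
      (fun k' => Function.update w j y (s k')) = fun k' => w (s k') :=
    fun w j y => Function.update_comp_eq_of_forall_ne' w y j.2
  have hB : ∀ (w : ∀ i, M i) (k : κ) (y : M (s k)),
      (fun j : {j // ∀ k, s k ≠ j} => Function.update w (s k) y j) =
        fun j : {j // ∀ k, s k ≠ j} => w j :=
    fun w k y => Function.update_comp_eq_of_forall_ne' w y fun j : {j // ∀ k, s k ≠ j} =>
      (j.2 k).symm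
  have hB' : ∀ (w : ∀ i, M i) (j : {j // ∀ k, s k ≠ j}) (y : M j),
      (fun j' : {j // ∀ k, s k ≠ j} => Function.update w j y j') =
        Function.update (fun j' : {j // ∀ k, s k ≠ j} => w j') j y :=
    fun w j y => Function.update_comp_eq_of_injective' w Subtype.val_injective j y
  refine ⟨MultilinearMap.mk' (fun w => A (fun k => w (s k)) * B fun j => w j) ?_ ?_, fun _ => rfl⟩
  · intro w i y z
    by_cases h : ∀ k, s k ≠ i
    · rw [hA' w ⟨i, h⟩, hA' w ⟨i, h⟩, hA' w ⟨i, h⟩, hB' w ⟨i, h⟩, hB' w ⟨i, h⟩, hB' w ⟨i, h⟩,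
        B.map_update_add, mul_add]
    · push Not at h
      obtain ⟨k, rfl⟩ := h
      rw [hA, hA, hA, hB, hB, hB, A.map_update_add, add_mul]
  · intro w i c y
    by_cases h : ∀ k, s k ≠ i
    · rw [hA' w ⟨i, h⟩, hA' w ⟨i, h⟩, hB' w ⟨i, h⟩, hB' w ⟨i, h⟩, B.map_update_smul, smul_eq_mul,
        smul_eq_mul, mul_left_comm]
    · push Not at h
      obtain ⟨k, rfl⟩ := h
      rw [hA, hA, hB, hB, A.map_update_smul, smul_mul_assoc]

namespace QuantumSet

/-! ### Atomic formulas in coordinates -/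

section Atomic

variable {n m : ℕ} {𝒳 : Fin n → QuantumSet.{u, v}} {𝒴 : Fin m → QuantumSet.{u, v}}

/-- The vector in the place of a variable, as a linear function of the vector in the context. -/
def Var.vecLin {Y : QuantumSet.{u, v}} (x : Var 𝒳 Y) (a : ∀ i, (𝒳 i).At) :
    (𝒳 x.idx).H (a x.idx) →ₗ[ℂ] Y.H (x.atom a) :=
  match Y, x with
  | _, ⟨_, rfl⟩ => LinearMap.id

theorem Var.vec_eq_vecLin {Y : QuantumSet.{u, v}} (x : Var 𝒳 Y) (a : ∀ i, (𝒳 i).At)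
    (w : ∀ i, (𝒳 i).H (a i)) : x.vec a w = x.vecLin a (w x.idx) := by
  obtain ⟨i, rfl⟩ := x
  rfl

theorem exists_atomic_functional {a : ∀ i, (𝒳 i).At} {x : ∀ k, Var 𝒳 (𝒴 k)}
    (hx : Function.Injective fun k => (x k).idx) (ξ : Functional 𝒴 fun k => (x k).atom a)
    (η : Functional (fun j : {j : Fin n // ∀ k, (x k).idx ≠ j} => 𝒳 j) fun j => a j) :
    ∃ ζ : Functional 𝒳 a, ∀ w, ζ w = ξ (fun k => (x k).vec a w) * η fun j => w j := by
  obtain ⟨f, hf⟩ := MultilinearMap.exists_mul (M := fun i => (𝒳 i).H (a i)) hx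
    (ξ.compLinearMap fun k => (x k).vecLin a) η
  refine ⟨f, fun w => (hf w).trans ?_⟩
  simp only [Var.vec_eq_vecLin]
  rfl

/-- An interpretation of an atomic formula consists of the functionals all of whose slices, obtained
by fixing basis vectors in the places that are not arguments, belong to the relation. -/
theorem mem_interpAtomic_iff {a : ∀ i, (𝒳 i).At} (R : Rel 𝒴) {x : ∀ k, Var 𝒳 (𝒴 k)}
    (hx : Function.Injective fun k => (x k).idx) (ζ : Functional 𝒳 a) :
    ζ ∈ interpAtomic R x a ↔ ∀ κ : Idx 𝒳 a, ∃ ξ ∈ R fun k => (x k).atom a,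
      ∀ κ' : Idx 𝒳 a, (∀ j, (∀ k, (x k).idx ≠ j) → κ' j = κ j) →
        ζ (basisVec κ') = ξ fun k => (x k).vec a (basisVec κ') := by
  classical
  constructor
  · intro h κ
    -- A slice of a product ξ ⊗ η is a multiple of ξ, and the condition on slices is linear.
    induction h using Submodule.span_induction with
    | mem ζ h =>
      obtain ⟨ξ, hξ, η, e⟩ := h
      refine ⟨η (fun j => basisVec κ j) • ξ, Submodule.smul_mem _ _ hξ, fun κ' h => ?_⟩
      have : (fun j : {j : Fin n // ∀ k, (x k).idx ≠ j} => basisVec κ' j) =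
          fun j : {j : Fin n // ∀ k, (x k).idx ≠ j} => basisVec κ j :=
        funext fun j : {j : Fin n // ∀ k, (x k).idx ≠ j} => by simp only [basisVec, h j j.2]
      rw [e, this, smul_apply, smul_eq_mul, mul_comm]
    | zero => exact ⟨0, zero_mem _, fun _ _ => rfl⟩
    | add ζ ζ' _ _ h h' =>
      obtain ⟨ξ, hξ, e⟩ := h
      obtain ⟨ξ', hξ', e'⟩ := h'
      exact ⟨ξ + ξ', add_mem hξ hξ', fun κ' h => by rw [add_apply, add_apply, e κ' h, e' κ' h]⟩
    | smul c ζ _ h =>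
      obtain ⟨ξ, hξ, e⟩ := h
      exact ⟨c • ξ, Submodule.smul_mem _ c hξ, fun κ' h => by rw [smul_apply, smul_apply, e κ' h]⟩
  · intro h
    choose ξ hξ e using h
    have : ∀ i, Nonempty (Fin (Module.finrank ℂ ((𝒳 i).H (a i)))) := fun i =>
      ⟨⟨0, Module.finrank_pos⟩⟩
    -- Filler for the argument places: the slice chosen for an index is valid for all indices
    -- agreeing with it in the remaining places.
    let κ₀ : Idx 𝒳 a := fun i => Classical.arbitrary _
    let J := {j : Fin n // ∀ k, (x k).idx ≠ j}
    let ext : (∀ j : J, Fin (Module.finrank ℂ ((𝒳 j).H (a j)))) → Idx 𝒳 a := fun μ i =>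
      if h : ∀ k, (x k).idx ≠ i then μ ⟨i, h⟩ else κ₀ i
    let η : (∀ j : J, Fin (Module.finrank ℂ ((𝒳 j).H (a j)))) →
        Functional (fun j : J => 𝒳 j) fun j => a j := fun μ =>
      (MultilinearMap.mkPiAlgebra ℂ J ℂ).compLinearMap fun j =>
        (innerSL ℂ ((𝒳 j).onb (a j) (μ j))).toLinearMap
    choose f hf using fun μ => exists_atomic_functional hx (ξ (ext μ)) (η μ)
    -- Expansion in the remaining factors: the coefficient of the basis functional `η μ` is the
    -- slice `ξ (ext μ)`.
    have hζ : ζ = ∑ μ, f μ := by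
      refine functional_ext fun κ => ?_
      have hη : ∀ μ, η μ (fun j : J => basisVec κ j) = if μ = fun j : J => κ j then 1 else 0 := by
        intro μ
        have : η μ (fun j : J => basisVec κ j) = ∏ j : J, if μ j = κ j then 1 else 0 := by
          simp only [η, MultilinearMap.compLinearMap_apply, MultilinearMap.mkPiAlgebra_apply]
          exact Finset.prod_congr rfl fun (j : J) _ => by
            simpa using orthonormal_iff_ite.1 ((𝒳 j).onb (a j)).orthonormal (μ j) (κ j)
        rw [this]
        split_ifs with h
        · exact Finset.prod_eq_one fun j _ => by rw [h, if_pos rfl]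
        · obtain ⟨j, hj⟩ := Function.ne_iff.1 h
          exact Finset.prod_eq_zero (Finset.mem_univ j) (if_neg hj)
      rw [functional_sum_apply, Finset.sum_eq_single fun j : J => κ j]
      · rw [hf, hη, if_pos rfl, mul_one]
        refine e _ _ fun j hj => ?_
        simp only [ext, dif_pos hj]
      · intro μ _ hμ
        rw [hf, hη, if_neg hμ, mul_zero]
      · exact fun h => absurd (Finset.mem_univ _) h
    rw [hζ]
    exact Submodule.sum_mem _ fun μ _ => Submodule.subset_span ⟨_, hξ _, _, hf μ⟩

end Atomic

/-! ### Functionals on products with two distinguished factors -/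

section Tensor

variable {n : ℕ} {X Y : QuantumSet.{u, v}} {𝒳 : Fin n → QuantumSet.{u, v}}

/-- An index of the basis of the first factor, followed by indices for the other factors. -/
abbrev consIdx {b : X.At} {a : ∀ i, (𝒳 i).At} (k : Fin (Module.finrank ℂ (X.H b))) (κ : Idx 𝒳 a) :
    Idx (Matrix.vecCons X 𝒳) (consAt b a) := Fin.cons k κ

theorem sum_consIdx {b : X.At} {a : ∀ i, (𝒳 i).At}
    (f : Idx (Matrix.vecCons X 𝒳) (consAt b a) → ℂ) :
    ∑ κ, f κ = ∑ k, ∑ κ : Idx 𝒳 a, f (consIdx k κ) := by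
  rw [← (Fin.consEquiv fun i => Fin (Module.finrank ℂ ((Matrix.vecCons X 𝒳 i).H
    (consAt b a i)))).sum_comp, Fintype.sum_prod_type]
  rfl

/-- The functional `β ⊗ ζ`, for a bilinear form `β`. -/
def tensor₂ {p : X.At} {q : Y.At} {a : ∀ i, (𝒳 i).At} (β : X.H p →ₗ[ℂ] Y.H q →ₗ[ℂ] ℂ)
    (ζ : Functional 𝒳 a) :
    Functional (Matrix.vecCons X (Matrix.vecCons Y 𝒳)) (consAt p (consAt q a)) :=
  ∑ i, tensor (innerSL ℂ (X.onb p i))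
    (tensor (LinearMap.toContinuousLinearMap (β (X.onb p i))) ζ)

theorem tensor₂_apply {p : X.At} {q : Y.At} {a : ∀ i, (𝒳 i).At}
    (β : X.H p →ₗ[ℂ] Y.H q →ₗ[ℂ] ℂ) (ζ : Functional 𝒳 a)
    (w : ∀ i, (Matrix.vecCons X (Matrix.vecCons Y 𝒳) i).H (consAt p (consAt q a) i)) :
    tensor₂ β ζ w = β (w 0) (w 1) * ζ fun i => w i.succ.succ := by
  have h : ∀ (x : X.H p) (y : Y.H q),
      ∑ i, inner ℂ (X.onb p i) x * β (X.onb p i) y = β x y := fun x y => by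
    conv_rhs => rw [← (X.onb p).sum_repr' x]
    simp only [map_sum, map_smul, LinearMap.sum_apply, LinearMap.smul_apply, smul_eq_mul]
  refine ((functional_sum_apply _ _ _).trans ?_).trans
    (congrArg (· * ζ fun i => w i.succ.succ) (h (w 0) (w 1)))
  rw [Finset.sum_mul]
  exact Finset.sum_congr rfl fun i _ => (mul_assoc _ _ _).symm

/-- The bilinear form `(x, φ) ↦ φ (r x)`. -/
def bendForm {p : X.At} {q : Y.At} (r : X.H p →L[ℂ] Y.H q) :
    X.H p →ₗ[ℂ] Y.dual.H q →ₗ[ℂ] ℂ :=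
  (ContinuousLinearMap.coeLM ℂ : StrongDual ℂ (Y.H q) →ₗ[ℂ] Y.H q →ₗ[ℂ] ℂ).flip ∘ₗ r.toLinearMap

theorem exists_at_eq (A : ∀ k : Fin 2, (![X, Y] k).At) :
    ∃ p q, A = consAt p (consAt q finZeroElim) := by
  refine ⟨A 0, A 1, funext fun k => ?_⟩
  fin_cases k <;> rfl

theorem exists_functional₂ (A : ∀ k : Fin 2, (![X, Y] k).At) :
    let p : X.At := A 0
    let q : Y.At := A 1
    ∀ β : X.H p →ₗ[ℂ] Y.H q →ₗ[ℂ] ℂ, ∃ ζ : Functional ![X, Y] A, ∀ w, ζ w = β (w 0) (w 1) := by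
  obtain ⟨p, q, rfl⟩ := exists_at_eq A
  intro _ _ β
  refine ⟨tensor₂ β (MultilinearMap.constOfIsEmpty ℂ _ 1), fun w => ?_⟩
  exact (tensor₂_apply _ _ _).trans (mul_one _)

theorem exists_bend_functional (A : ∀ k : Fin 2, (![X, Y.dual] k).At) :
    let p : X.At := A 0
    let q : Y.At := A 1
    ∀ r : X.H p →L[ℂ] Y.H q, ∃ ζ : Functional ![X, Y.dual] A,
      ∀ w, let φ : StrongDual ℂ (Y.H q) := w 1; ζ w = φ (r (w 0)) :=
  fun r => exists_functional₂ A (bendForm r)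

theorem exists_conjugate_functional {a : ∀ i, (𝒳 i).At} (ξ : Functional 𝒳 a) :
    ∃ θ : Functional (fun i => (𝒳 i).dual) a, ∀ η, θ η = innerFunctional ξ (prodFunctional η) := by
  refine ⟨∑ κ : Idx 𝒳 a, conj (ξ (basisVec κ)) •
    (MultilinearMap.mkPiAlgebra ℂ (Fin n) ℂ).compLinearMap fun i =>
      (NormedSpace.inclusionInDoubleDual ℂ _ (basisVec κ i)).toLinearMap, fun η => ?_⟩
  exact functional_sum_apply (𝒳 := fun i => (𝒳 i).dual) _ _ _

/-! ### The dual basis -/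

theorem sum_inner_onb (X : QuantumSet.{u, v}) (b : X.At) (x y : X.H b) :
    ∑ j, inner ℂ x (X.onb b j) * inner ℂ (X.onb b j) y = inner ℂ x y :=
  (X.onb b).sum_inner_mul_inner x y

/-- Parseval's identity in the dual, for the Riesz representatives of `x` and `y`. It stands in for
duality of bases: the orthonormal bases chosen on an atom and on its dual need not be related. -/
theorem sum_conj_onb_dual (X : QuantumSet.{u, v}) (b : X.At) (y x : X.H b) :
    ∑ j, conj ((X.dual.onb b j : StrongDual ℂ (X.H b)) y) *
      (X.dual.onb b j : StrongDual ℂ (X.H b)) x = inner ℂ y x := by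
  have h : ∀ φ ψ : X.dual.H b, @inner ℂ (X.dual.H b) (X.dual.hilbert b).toInner φ ψ =
      inner ℂ ((InnerProductSpace.toDual ℂ (X.H b)).symm ψ)
        ((InnerProductSpace.toDual ℂ (X.H b)).symm φ) := fun _ _ => rfl
  have := X.dual.sum_inner_onb b (InnerProductSpace.toDual ℂ (X.H b) x)
    (InnerProductSpace.toDual ℂ (X.H b) y)
  simp only [h, LinearIsometryEquiv.symm_apply_apply, InnerProductSpace.toDual_symm_apply] at this
  rw [← this]
  refine Finset.sum_congr rfl fun j _ => ?_
  rw [mul_comm, ← inner_conj_symm y, InnerProductSpace.toDual_symm_apply]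

theorem eq_of_onb_dual {X : QuantumSet.{u, v}} {b : X.At} {y z : X.H b}
    (h : ∀ j, (X.dual.onb b j : StrongDual ℂ (X.H b)) y =
      (X.dual.onb b j : StrongDual ℂ (X.H b)) z) : y = z := by
  refine ext_inner_right ℂ fun x => ?_
  rw [← sum_conj_onb_dual, ← sum_conj_onb_dual]
  simp only [h]

/-- The conjugate of `[R]` consists of the functionals `(φ, y) ↦ φ (t^† y)`, for `t` in `R`. -/
theorem mem_bendConj_iff (R : BinRel X Y) (A : ∀ k : Fin 2, (![X.dual, Y] k).At)
    (ζ : Functional ![X.dual, Y] A) :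
    ζ ∈ bendConj R A ↔
      let p : X.At := A 0
      let q : Y.At := A 1
      ∃ t ∈ R p q, ∀ w, let φ : StrongDual ℂ (X.H p) := w 0
        ζ w = φ (ContinuousLinearMap.adjoint t (w 1)) := by
  obtain ⟨p, q, rfl⟩ := exists_at_eq A
  -- In coordinates, the sum over the dual basis of `Y` gives ⟨t eᵢ | y⟩ = ⟨eᵢ | t^† y⟩, and the sum
  -- over i reassembles t^† y inside φ.
  have key : ∀ (t : X.H p →L[ℂ] Y.H q)
      (ξ : Functional ![X, Y.dual] (consAt p (consAt q finZeroElim)))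
      (_ : ∀ w, let φ : StrongDual ℂ (Y.H q) := w 1; ξ w = φ (t (w 0)))
      (φ : StrongDual ℂ (X.H p)) (y : Y.H q),
      innerFunctional ξ (prodFunctional (𝒳 := ![X, Y.dual])
        (a := consAt p (consAt q finZeroElim)) (Fin.cons φ
        (Fin.cons (NormedSpace.inclusionInDoubleDual ℂ (Y.H q) y) finZeroElim))) =
      φ (ContinuousLinearMap.adjoint t y) := by
    intro t ξ hξ φ y
    rw [innerFunctional_eq, sum_consIdx]
    have h : ∀ (i : Fin (Module.finrank ℂ (X.H p))),
        (∑ κ : Idx ![Y.dual] (consAt q finZeroElim), conj (ξ (basisVec (consIdx i κ))) *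
          (prodFunctional (𝒳 := ![X, Y.dual])
            (a := consAt p (consAt q finZeroElim)) (Fin.cons φ
            (Fin.cons (NormedSpace.inclusionInDoubleDual ℂ (Y.H q) y) finZeroElim)))
            (basisVec (consIdx i κ))) =
        inner ℂ (X.onb p i) (ContinuousLinearMap.adjoint t y) * φ (X.onb p i) := by
      intro i
      rw [sum_consIdx, ContinuousLinearMap.adjoint_inner_right, ← sum_conj_onb_dual,
        Finset.sum_mul]
      refine Finset.sum_congr rfl fun j _ => ?_
      rw [Fintype.sum_unique, hξ]
      refine (congrArg (fun z : ℂ => _ * z) (Fin.prod_univ_two _)).trans ?_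
      change conj ((Y.dual.onb q j : StrongDual ℂ (Y.H q)) (t (X.onb p i))) *
        (φ (X.onb p i) * (Y.dual.onb q j : StrongDual ℂ (Y.H q)) y) = _
      ring
    simp only [h]
    conv_rhs => rw [← (X.onb p).sum_repr' (ContinuousLinearMap.adjoint t y)]
    simp only [map_sum, map_smul, smul_eq_mul]
  constructor
  · rintro ⟨θ, ⟨ξ, ⟨t, ht, e⟩, e'⟩, e''⟩
    refine ⟨t, ht, fun w => (e'' w).trans ((e' _).trans (key t ξ e _ _))⟩
  · rintro ⟨t, ht, e⟩
    obtain ⟨ξ, hξ⟩ := exists_bend_functional (X := X) (Y := Y)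
      (consAt (X := X) p (consAt (X := Y.dual) q finZeroElim)) t
    obtain ⟨θ, hθ⟩ := exists_conjugate_functional ξ
    exact ⟨θ, ⟨ξ, ⟨t, ht, hξ⟩, hθ⟩, fun w => (e w).trans ((hθ _).trans (key t ξ hξ _ _)).symm⟩

/-! ### Atomic formulas with two arguments -/

/-- The arguments of an atomic formula `R(xᵢ, xⱼ)`. -/
abbrev pairVar {i j : Fin n} (hi : 𝒳 i = X) (hj : 𝒳 j = Y) : ∀ k : Fin 2, Var 𝒳 (![X, Y] k) :=
  Fin.cons ⟨i, hi⟩ (Fin.cons ⟨j, hj⟩ finZeroElim)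

theorem pairVar_injective {i j : Fin n} (hi : 𝒳 i = X) (hj : 𝒳 j = Y) (hij : i ≠ j) :
    Function.Injective fun k => (pairVar hi hj k).idx := fun k l => by
  fin_cases k <;> fin_cases l <;> first | exact fun _ => rfl | exact fun h => absurd h hij |
    exact fun h => absurd h.symm hij

theorem mem_atomic₂_iff {a : ∀ i, (𝒳 i).At} (R : Rel ![X, Y]) {i j : Fin n} (hi : 𝒳 i = X)
    (hj : 𝒳 j = Y) (hij : i ≠ j) (ζ : Functional 𝒳 a) :
    ζ ∈ (Formula.atomic₂ R i j hi hj hij).interp a ↔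
      ∀ κ : Idx 𝒳 a, ∃ ξ ∈ R fun k => (pairVar hi hj k).atom a,
        ∀ κ' : Idx 𝒳 a, (∀ l, l ≠ i → l ≠ j → κ' l = κ l) →
          ζ (basisVec κ') = ξ fun k => (pairVar hi hj k).vec a (basisVec κ') := by
  refine (mem_interpAtomic_iff R (pairVar_injective hi hj hij) ζ).trans ?_
  have : ∀ l, (∀ k, (pairVar hi hj k).idx ≠ l) ↔ l ≠ i ∧ l ≠ j := fun l => by
    rw [Fin.forall_fin_two]
    exact and_congr ne_comm ne_comm
  simp only [this, and_imp]

theorem mem_atomic₂_bend_iff {a : ∀ i, (𝒳 i).At} (R : BinRel X Y) {i j : Fin n} (hi : 𝒳 i = X)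
    (hj : 𝒳 j = Y.dual) (hij : i ≠ j) (ζ : Functional 𝒳 a) :
    let p : X.At := Var.atom ⟨i, hi⟩ a
    let q : Y.At := Var.atom (Y := Y.dual) ⟨j, hj⟩ a
    ζ ∈ (Formula.atomic₂ (bend R) i j hi hj hij).interp a ↔
      ∀ κ : Idx 𝒳 a, ∃ r ∈ R p q,
        ∀ κ' : Idx 𝒳 a, (∀ l, l ≠ i → l ≠ j → κ' l = κ l) →
          let φ : StrongDual ℂ (Y.H q) := Var.vec (Y := Y.dual) ⟨j, hj⟩ a (basisVec κ')
          ζ (basisVec κ') = φ (r (Var.vec ⟨i, hi⟩ a (basisVec κ'))) := by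
  intro p q
  refine (mem_atomic₂_iff (bend R) hi hj hij ζ).trans (forall_congr' fun κ => ?_)
  constructor
  · rintro ⟨ξ, ⟨r, hr, e⟩, h⟩
    exact ⟨r, hr, fun κ' h' => (h κ' h').trans (e _)⟩
  · rintro ⟨r, hr, h⟩
    obtain ⟨ξ, hξ⟩ := exists_bend_functional (X := X) (Y := Y)
      (fun k => (pairVar (Y := Y.dual) hi hj k).atom a) r
    exact ⟨ξ, ⟨r, hr, hξ⟩, fun κ' h' =>
      (h κ' h').trans (hξ fun k => (pairVar (Y := Y.dual) hi hj k).vec a (basisVec κ')).symm⟩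

theorem mem_atomic₂_bendConj_iff {a : ∀ i, (𝒳 i).At} (R : BinRel X Y) {i j : Fin n}
    (hi : 𝒳 i = X.dual) (hj : 𝒳 j = Y) (hij : i ≠ j) (ζ : Functional 𝒳 a) :
    let p : X.At := Var.atom (Y := X.dual) ⟨i, hi⟩ a
    let q : Y.At := Var.atom ⟨j, hj⟩ a
    ζ ∈ (Formula.atomic₂ (bendConj R) i j hi hj hij).interp a ↔
      ∀ κ : Idx 𝒳 a, ∃ t ∈ R p q,
        ∀ κ' : Idx 𝒳 a, (∀ l, l ≠ i → l ≠ j → κ' l = κ l) →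
          let φ : StrongDual ℂ (X.H p) := Var.vec (Y := X.dual) ⟨i, hi⟩ a (basisVec κ')
          ζ (basisVec κ') =
            φ (ContinuousLinearMap.adjoint t (Var.vec ⟨j, hj⟩ a (basisVec κ'))) := by
  intro p q
  refine (mem_atomic₂_iff (bendConj R) hi hj hij ζ).trans (forall_congr' fun κ => ?_)
  constructor
  · rintro ⟨ξ, hξ, h⟩
    obtain ⟨t, ht, e⟩ := (mem_bendConj_iff R _ ξ).1 hξ
    exact ⟨t, ht, fun κ' h' => (h κ' h').trans (e _)⟩
  · rintro ⟨t, ht, h⟩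
    obtain ⟨ξ, hξ⟩ := exists_functional₂ (X := X.dual) (Y := Y)
      (fun k => (pairVar (X := X.dual) hi hj k).atom a)
      (bendForm (X := Y) (Y := X) (ContinuousLinearMap.adjoint t)).flip
    exact ⟨ξ, (mem_bendConj_iff R _ ξ).2 ⟨t, ht, hξ⟩, fun κ' h' =>
      (h κ' h').trans (hξ fun k => (pairVar (X := X.dual) hi hj k).vec a (basisVec κ')).symm⟩

theorem evalPair_self (b : X.At) (x : X.H b) (φ : StrongDual ℂ (X.H b)) :
    evalPair X b b x φ = φ x := by
  simp [evalPair]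

theorem mem_atomic₂_eqRel_iff {a : ∀ i, (𝒳 i).At} {i j : Fin n} (hi : 𝒳 i = X)
    (hj : 𝒳 j = X.dual) (hij : i ≠ j) (ζ : Functional 𝒳 a) :
    let p : X.At := Var.atom ⟨i, hi⟩ a
    let q : X.At := Var.atom (Y := X.dual) ⟨j, hj⟩ a
    ζ ∈ (Formula.atomic₂ (eqRel X) i j hi hj hij).interp a ↔
      ∀ κ : Idx 𝒳 a, ∃ c : ℂ,
        ∀ κ' : Idx 𝒳 a, (∀ l, l ≠ i → l ≠ j → κ' l = κ l) →
          ζ (basisVec κ') = c * evalPair X p q (Var.vec ⟨i, hi⟩ a (basisVec κ'))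
            (Var.vec (Y := X.dual) ⟨j, hj⟩ a (basisVec κ')) := by
  intro p q
  refine (mem_atomic₂_iff (eqRel X) hi hj hij ζ).trans (forall_congr' fun κ => ?_)
  constructor
  · rintro ⟨ξ, ⟨c, e⟩, h⟩
    exact ⟨c, fun κ' h' => (h κ' h').trans (e _)⟩
  · rintro ⟨c, h⟩
    let A : ∀ k : Fin 2, (![X, X.dual] k).At := fun k =>
      (pairVar (Y := X.dual) hi hj k).atom a
    obtain ⟨ξ, hξ⟩ : ∃ ξ : Functional ![X, X.dual] A, ∀ w,
        ξ w = c * evalPair X p q (w 0) (w 1) := by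
      by_cases hpq : p = q
      -- On equal atoms, c times the evaluation is the bending of c times the identity. The second
      -- atom is generalized so that the equality can be eliminated.
      · have : ∀ q' (_ : p = q'), ∃ r : X.H p →L[ℂ] X.H q',
            ∀ (x : X.H p) (φ : StrongDual ℂ (X.H q')),
            φ (r x) = c * evalPair X p q' x φ := by
          rintro q' rfl
          exact ⟨c • ContinuousLinearMap.id ℂ _, fun x φ => by simp [evalPair_self]⟩
        obtain ⟨r, hr⟩ := this q hpq
        obtain ⟨ξ, hξ⟩ := exists_bend_functional (X := X) (Y := X) A r
        exact ⟨ξ, fun w => (hξ w).trans (hr _ _)⟩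
      · exact ⟨0, fun w => by simp [evalPair, hpq]⟩
    exact ⟨ξ, ⟨c, hξ⟩, fun κ' h' =>
      (h κ' h').trans (hξ fun k => (pairVar (Y := X.dual) hi hj k).vec a (basisVec κ')).symm⟩

end Tensor

/-! ### The diagonal quantifier -/

section Diagonal

variable {n : ℕ} {X : QuantumSet.{u, v}} {𝒳 : Fin n → QuantumSet.{u, v}}

/-- The functional `E ⊗ ζ`, where `E` is the evaluation on the atom `b` and its dual. -/
def diag {a : ∀ i, (𝒳 i).At} (b : X.At) (ζ : Functional 𝒳 a) :
    Functional (Matrix.vecCons X (Matrix.vecCons X.dual 𝒳))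
      (consAt b (consAt (X := X.dual) b a)) :=
  tensor₂ (Y := X.dual) (bendForm (X := X) (Y := X) (ContinuousLinearMap.id ℂ _)) ζ

theorem diag_basisVec {a : ∀ i, (𝒳 i).At} (b : X.At) (ζ : Functional 𝒳 a)
    (k : Fin (Module.finrank ℂ (X.H b))) (l : Fin (Module.finrank ℂ (X.dual.H b))) (κ : Idx 𝒳 a) :
    diag b ζ (basisVec (consIdx k (consIdx (X := X.dual) l κ))) =
      (X.dual.onb b l : StrongDual ℂ (X.H b)) (X.onb b k) * ζ (basisVec κ) :=
  tensor₂_apply _ _ _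

theorem consIdx_self {Y : QuantumSet.{u, v}} {b : X.At} {c : Y.At} {a : ∀ i, (𝒳 i).At}
    (κ : Idx (Matrix.vecCons X (Matrix.vecCons Y 𝒳)) (consAt b (consAt c a))) :
    ∃ k l κ', κ = consIdx k (consIdx l κ') :=
  ⟨κ 0, κ 1, fun i => κ i.succ.succ, by
    funext i
    refine Fin.cases rfl (fun i => ?_) i
    exact Fin.cases rfl (fun i => rfl) i⟩

theorem diag_mem_eqRel {a : ∀ i, (𝒳 i).At} (b : X.At) (ζ : Functional 𝒳 a) :
    diag b ζ ∈ (Formula.atomic₂ (𝒳 := Matrix.vecCons X (Matrix.vecCons X.dual 𝒳)) (eqRel X) 0 1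
      rfl rfl (by simp)).interp (consAt b (consAt (X := X.dual) b a)) := by
  refine (mem_atomic₂_eqRel_iff _ _ _ _).2 fun κ => ?_
  obtain ⟨k, l, κ, rfl⟩ := consIdx_self κ
  refine ⟨ζ (basisVec κ), fun κ' h => ?_⟩
  obtain ⟨k', l', κ', rfl⟩ := consIdx_self κ'
  obtain rfl : κ' = κ := funext fun i =>
    h i.succ.succ (Fin.succ_ne_zero _) fun h => Fin.succ_ne_zero _ (Fin.succ_injective _ h)
  exact (diag_basisVec _ _ _ _ _).trans ((mul_comm _ _).trans
    (congrArg (ζ (basisVec κ') * ·) (evalPair_self _ _ _).symm))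

theorem exists_coeff_of_mem_eqRel {a : ∀ i, (𝒳 i).At} {b c : X.At}
    {θ : Functional (Matrix.vecCons X (Matrix.vecCons X.dual 𝒳))
      (consAt b (consAt (X := X.dual) c a))}
    (h : θ ∈ (Formula.atomic₂ (𝒳 := Matrix.vecCons X (Matrix.vecCons X.dual 𝒳)) (eqRel X) 0 1
      rfl rfl (by simp)).interp (consAt b (consAt (X := X.dual) c a))) (κ : Idx 𝒳 a) :
    ∃ d : ℂ, ∀ k l, θ (basisVec (consIdx k (consIdx (X := X.dual) l κ))) =
      d * evalPair X b c (X.onb b k) (X.dual.onb c l) := by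
  have : ∀ (X : QuantumSet.{u, v}) (b : X.At), Nonempty (Fin (Module.finrank ℂ (X.H b))) :=
    fun X b => ⟨⟨0, Module.finrank_pos⟩⟩
  obtain ⟨k₀⟩ := this X b
  obtain ⟨l₀⟩ := this X.dual c
  obtain ⟨d, hd⟩ := (mem_atomic₂_eqRel_iff _ _ _ _).1 h (consIdx k₀ (consIdx (X := X.dual) l₀ κ))
  refine ⟨d, fun k l => hd _ fun i => ?_⟩
  refine Fin.cases (fun h _ => absurd rfl h) (fun i => ?_) i
  exact Fin.cases (fun _ h => absurd rfl h) (fun i _ _ => rfl) i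

/-- The squared norm of the evaluation; it normalizes the projection onto its span. -/
theorem sum_onb_dual_apply (X : QuantumSet.{u, v}) (b : X.At) :
    ∑ k, ∑ l, conj ((X.dual.onb b l : StrongDual ℂ (X.H b)) (X.onb b k)) *
      (X.dual.onb b l : StrongDual ℂ (X.H b)) (X.onb b k) = Module.finrank ℂ (X.H b) :=
  (Finset.sum_congr rfl fun k _ => sum_conj_onb_dual X b _ _).trans (by simp)

/-- The projection of ξ ⊗ ξ' ⊗ ζ onto the equality relation is a multiple of `diag b ζ` on equal
atoms and zero on distinct ones. Conversely, `diag b ζ` is a sum of such tensors and already lies in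
the equality relation. -/
theorem mem_allDiag_iff {a : ∀ i, (𝒳 i).At}
    (φ : Formula (Matrix.vecCons X (Matrix.vecCons X.dual 𝒳))) (ζ : Functional 𝒳 a) :
    ζ ∈ (Formula.allDiag X φ).interp a ↔
      ∀ b, diag b ζ ∈ φ.interp (consAt b (consAt (X := X.dual) b a)) := by
  unfold Formula.allDiag
  rw [mem_all_iff]
  simp only [mem_all_iff]
  constructor
  · intro h b
    refine (mem_imp_iff_of_mem (diag_mem_eqRel b ζ)).1 ?_
    exact Submodule.sum_mem _ fun k _ => h b _ b _
  · intro h c ξ' b ξ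
    rw [mem_imp_iff]
    by_cases hbc : b = c
    · obtain rfl := hbc
      have hN : (Module.finrank ℂ (X.H b) : ℂ) ≠ 0 :=
        Nat.cast_ne_zero.2 Module.finrank_pos.ne'
      -- With E the evaluation, s = ⟨E | ξ ⊗ ξ'⟩ and ‖E‖² is the dimension of the atom, so the
      -- projection is (s / dim) E ⊗ ζ.
      set s : ℂ := ∑ k, ∑ l, conj ((X.dual.onb b l : StrongDual ℂ (X.H b)) (X.onb b k)) *
        (ξ (X.onb b k) * ξ' (X.dual.onb b l)) with hs
      refine ⟨(s / Module.finrank ℂ (X.H b)) • diag b ζ,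
        Submodule.smul_mem _ _ (diag_mem_eqRel b ζ),
        Submodule.smul_mem _ _ (h b), fun θ hθ => ?_⟩
      choose d hd using exists_coeff_of_mem_eqRel hθ
      rw [innerFunctional_eq, sum_consIdx]
      have key : ∀ (k : Fin (Module.finrank ℂ (X.H b))) (l : Fin (Module.finrank ℂ (X.dual.H b)))
          (κ : Idx 𝒳 a), conj (θ (basisVec (consIdx k (consIdx (X := X.dual) l κ)))) *
            (tensor ξ (tensor (X := X.dual) ξ' ζ) -
              (s / Module.finrank ℂ (X.H b)) • diag b ζ)
              (basisVec (consIdx k (consIdx (X := X.dual) l κ))) =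
          (conj ((X.dual.onb b l : StrongDual ℂ (X.H b)) (X.onb b k)) *
              (ξ (X.onb b k) * ξ' (X.dual.onb b l)) -
            s / Module.finrank ℂ (X.H b) *
              (conj ((X.dual.onb b l : StrongDual ℂ (X.H b)) (X.onb b k)) *
                (X.dual.onb b l : StrongDual ℂ (X.H b)) (X.onb b k))) *
            (conj (d κ) * ζ (basisVec κ)) := by
        intro k l κ
        rw [hd, evalPair_self, map_mul]
        refine (congrArg (fun z : ℂ => _ * z) (congrArg (fun z : ℂ => _ - _ * z)
          (diag_basisVec b ζ k l κ))).trans ?_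
        change _ * (ξ (X.onb b k) * (ξ' (X.dual.onb b l) * ζ (basisVec κ)) - _) = _
        ring
      have key' : ∀ k, (∑ κ : Idx (Matrix.vecCons X.dual 𝒳) (consAt (X := X.dual) b a),
          conj (θ (basisVec (consIdx k κ))) * (tensor ξ (tensor (X := X.dual) ξ' ζ) -
              (s / Module.finrank ℂ (X.H b)) • diag b ζ) (basisVec (consIdx k κ))) =
          (∑ l, (conj ((X.dual.onb b l : StrongDual ℂ (X.H b)) (X.onb b k)) *
              (ξ (X.onb b k) * ξ' (X.dual.onb b l)) -
            s / Module.finrank ℂ (X.H b) *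
              (conj ((X.dual.onb b l : StrongDual ℂ (X.H b)) (X.onb b k)) *
                (X.dual.onb b l : StrongDual ℂ (X.H b)) (X.onb b k)))) *
            ∑ κ, conj (d κ) * ζ (basisVec κ) := fun k => by
        rw [sum_consIdx, Finset.sum_mul_sum]
        simp only [key]
      rw [Finset.sum_congr rfl fun k _ => key' k, ← Finset.sum_mul]
      simp only [Finset.sum_sub_distrib, ← Finset.mul_sum, sum_onb_dual_apply]
      simp only [← hs]
      rw [div_mul_cancel₀ _ hN, sub_self, zero_mul]
    · refine ⟨0, zero_mem _, zero_mem _, fun θ hθ => ?_⟩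
      rw [innerFunctional_eq]
      refine Finset.sum_eq_zero fun κ _ => ?_
      obtain ⟨k, l, κ, rfl⟩ := consIdx_self κ
      obtain ⟨d, hd⟩ := exists_coeff_of_mem_eqRel hθ κ
      rw [hd]
      simp [evalPair, hbc]

end Diagonal

section Truth

variable {n : ℕ} {X : QuantumSet.{u, v}} {𝒳 : Fin n → QuantumSet.{u, v}}

/-! ### Reflexivity -/

/-- The unit functional of arity `()`. -/
abbrev unitFunctional : Functional (![] : Fin 0 → QuantumSet.{u, v}) finZeroElim :=
  MultilinearMap.constOfIsEmpty ℂ _ 1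

theorem isTrue_iff (φ : Formula (![] : Fin 0 → QuantumSet.{u, v})) :
    φ.IsTrue ↔ unitFunctional ∈ φ.interp finZeroElim := by
  constructor
  · intro h
    rw [show φ.interp = ⊤ from h]
    trivial
  · intro h
    funext a
    obtain rfl : a = finZeroElim := Subsingleton.elim _ _
    refine eq_top_iff.2 fun ζ _ => ?_
    have : ζ = ζ finZeroElim • unitFunctional := by
      ext w
      rw [Subsingleton.elim w finZeroElim]
      simp
    rw [this]
    exact Submodule.smul_mem _ _ h

/-- The standard orthonormal basis of the dual of an atom. -/
abbrev coonb (X : QuantumSet.{u, v}) (b : X.At) (l : Fin (Module.finrank ℂ (X.dual.H b))) :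
    StrongDual ℂ (X.H b) := X.dual.onb b l

instance (X : QuantumSet.{u, v}) (b : X.At) : Nonempty (Fin (Module.finrank ℂ (X.H b))) :=
  ⟨⟨0, Module.finrank_pos⟩⟩

theorem eq_of_coonb {b c : X.At} {r s : X.H b →L[ℂ] X.H c}
    (h : ∀ k l, X.coonb c l (r (X.onb b k)) = X.coonb c l (s (X.onb b k))) : r = s := by
  refine ContinuousLinearMap.coe_injective ((X.onb b).toBasis.ext fun k => ?_)
  rw [OrthonormalBasis.coe_toBasis]
  exact eq_of_onb_dual fun l => h k l

theorem reflexivity_isTrue_iff (R : BinRel X X) :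
    (reflexivity R).IsTrue ↔ ∀ b, ContinuousLinearMap.id ℂ (X.H b) ∈ R b b := by
  rw [isTrue_iff, reflexivity, mem_allDiag_iff]
  refine forall_congr' fun b => ?_
  refine (mem_atomic₂_bend_iff _ _ _ _ _).trans ?_
  have hd : ∀ k l κ, diag b (unitFunctional.{u, v})
      (basisVec (consIdx k (consIdx (X := X.dual) l κ))) =
      X.coonb b l (X.onb b k) := fun k l κ => (diag_basisVec _ _ _ _ _).trans (mul_one _)
  constructor
  · intro h
    obtain ⟨κ⟩ : Nonempty (Idx (Matrix.vecCons X (Matrix.vecCons X.dual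
      (![] : Fin 0 → QuantumSet.{u, v}))) (consAt b (consAt (X := X.dual) b finZeroElim))) :=
      ⟨fun i => Classical.arbitrary _⟩
    obtain ⟨(r : X.H b →L[ℂ] X.H b), (hr : r ∈ R b b), e⟩ := h κ
    suffices ContinuousLinearMap.id ℂ _ = r by rwa [this]
    refine eq_of_coonb fun k l => (hd k l finZeroElim).symm.trans
      (e (consIdx k (consIdx (X := X.dual) l finZeroElim)) ?_)
    intro i
    fin_cases i
    · exact fun h => absurd rfl h
    · exact fun _ h => absurd rfl h
  · intro h κ
    refine ⟨_, h, fun κ' _ => ?_⟩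
    obtain ⟨k, l, κ', rfl⟩ := consIdx_self κ'
    exact hd k l κ'

/-! ### Antisymmetry -/

/-- The operators between atoms that are zero on distinct atoms and scalar on equal ones. -/
def IsScalarBetween {b c : X.At} (r : X.H b →L[ℂ] X.H c) : Prop :=
  ∃ d : ℂ, ∀ x φ, φ (r x) = d * evalPair X b c x φ

theorem isScalarBetween_iff {b c : X.At} (r : X.H b →L[ℂ] X.H c) :
    IsScalarBetween r ↔ ∃ d : ℂ, ∀ k l,
      X.coonb c l (r (X.onb b k)) = d * evalPair X b c (X.onb b k) (X.coonb c l) := by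
  refine exists_congr fun d => ⟨fun h k l => h _ _, fun h => ?_⟩
  by_cases hbc : b = c
  · subst hbc
    have : r = d • ContinuousLinearMap.id ℂ _ := eq_of_coonb fun k l => by
      rw [h, evalPair_self]
      simp
    rw [this]
    exact fun x φ => by simp [evalPair_self]
  · have : r = 0 := eq_of_coonb fun k l => by simp [h, evalPair, hbc]
    rw [this]
    exact fun x φ => by simp [evalPair, hbc]

/-- The outer quantifiers drop out and the arrow becomes an inclusion. With no other variables, a
functional is (x, φ) ↦ φ(r x) for a single operator r; it is in [R] iff r is in R, and in [R]_* iff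
the adjoint of r is. -/
theorem antisymmetry_isTrue_iff (R : BinRel X X) :
    (antisymmetry R).IsTrue ↔ ∀ b c, ∀ r ∈ R b c, ContinuousLinearMap.adjoint r ∈ R c b →
      IsScalarBetween r := by
  rw [Formula.IsTrue, antisymmetry, all_interp_eq_top_iff, all_interp_eq_top_iff,
    imp_interp_eq_top_iff]
  -- Both places are arguments, so agreement in the remaining places is vacuous.
  have vac : ∀ {P : Fin 2 → Prop} (i : Fin 2), i ≠ 1 → i ≠ 0 → P i := fun i h h' => by
    fin_cases i <;> contradiction
  have vac' : ∀ {P : Fin 2 → Prop} (i : Fin 2), i ≠ 0 → i ≠ 1 → P i := fun i h h' => by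
    fin_cases i <;> contradiction
  constructor
  · intro h b c r hr hr'
    obtain ⟨ζ, hζ⟩ := exists_functional₂ (X := X.dual) (Y := X)
      (consAt (X := X.dual) c (consAt b finZeroElim)) (bendForm (X := X) (Y := X) r).flip
    have hζ' : ζ ∈ (Formula.atomic₂ (𝒳 := ![X.dual, X]) (eqRel X) 1 0 rfl rfl
        (by decide)).interp (consAt (X := X.dual) c (consAt b finZeroElim)) := by
      refine h _ ⟨?_, ?_⟩
      · exact (mem_atomic₂_bend_iff _ _ _ _ _).2 fun κ => ⟨r, hr, fun κ' _ => hζ _⟩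
      · refine (mem_atomic₂_bendConj_iff _ _ _ _ _).2 fun κ =>
          ⟨ContinuousLinearMap.adjoint r, hr', fun κ' _ => (hζ _).trans ?_⟩
        exact congrArg (fun s : X.H b →L[ℂ] X.H c => X.coonb c (κ' 0) (s (X.onb b (κ' 1))))
          (ContinuousLinearMap.adjoint_adjoint r).symm
    obtain ⟨d, hd⟩ := (mem_atomic₂_eqRel_iff _ _ _ _).1 hζ' fun i => Classical.arbitrary _
    refine (isScalarBetween_iff r).2 ⟨d, fun k l => ?_⟩
    exact (hζ (basisVec (consIdx (X := X.dual) l (consIdx k finZeroElim)))).symm.trans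
      (hd (consIdx (X := X.dual) l (consIdx k finZeroElim)) vac)
  · intro h A ζ hζ
    obtain ⟨c, b, rfl⟩ := exists_at_eq (X := X.dual) (Y := X) A
    obtain ⟨(r : X.H b →L[ℂ] X.H c), (hr : r ∈ R b c), e⟩ := (mem_atomic₂_bend_iff _ _ _ _ _).1 hζ.1
      fun i => Classical.arbitrary _
    obtain ⟨(t : X.H c →L[ℂ] X.H b), (ht : t ∈ R c b), e'⟩ :=
      (mem_atomic₂_bendConj_iff _ _ _ _ _).1 hζ.2
      fun i => Classical.arbitrary _
    have hrt : r = ContinuousLinearMap.adjoint t := eq_of_coonb fun k l =>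
      (e (consIdx (X := X.dual) l (consIdx k finZeroElim)) vac).symm.trans
        (e' (consIdx (X := X.dual) l (consIdx k finZeroElim)) vac')
    obtain ⟨d, hd⟩ := h b c r hr (by rw [hrt, ContinuousLinearMap.adjoint_adjoint]; exact ht)
    refine (mem_atomic₂_eqRel_iff _ _ _ _).2 fun κ => ⟨d, fun κ' _ => (e κ' vac).trans (hd _ _)⟩

end Truth

end QuantumSet

/-- The reproducing kernel of `W` at the entry (i, j): `g` is the projection of the matrix unit onto
`W`. -/
theorem Submodule.exists_reproducing {I J : Type*} [Fintype I] [Fintype J]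
    (W : Submodule ℂ (I → J → ℂ)) (i : I) (j : J) :
    ∃ g ∈ W, ∀ h ∈ W, h i j = ∑ i', ∑ j', conj (g i' j') * h i' j' := by
  classical
  let e : EuclideanSpace ℂ (I × J) ≃ₗ[ℂ] (I → J → ℂ) :=
    (WithLp.linearEquiv 2 ℂ _).trans (LinearEquiv.curry ℂ ℂ I J)
  let W' := W.comap e.toLinearMap
  let δ : EuclideanSpace ℂ (I × J) := EuclideanSpace.single (i, j) 1
  obtain ⟨p, hp, q, hq, hpq⟩ := Submodule.mem_sup.1
    (show δ ∈ W' ⊔ W'ᗮ by rw [Submodule.sup_orthogonal_of_hasOrthogonalProjection]; trivial)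
  refine ⟨e p, hp, fun h hh => ?_⟩
  have h₁ : inner ℂ δ (e.symm h) = h i j := by
    simp [δ, EuclideanSpace.inner_single_left, e]
  have h₂ : inner ℂ δ (e.symm h) = inner ℂ p (e.symm h) := by
    rw [← hpq, inner_add_left, (W'.mem_orthogonal' q).1 hq _ (by simpa [W'] using hh), add_zero]
  rw [← h₁, h₂, PiLp.inner_apply, Fintype.sum_prod_type]
  refine Finset.sum_congr rfl fun i' _ => Finset.sum_congr rfl fun j' _ => ?_
  rw [RCLike.inner_apply, mul_comm]
  rfl

namespace QuantumSet

theorem exists_functional_of_coords {n : ℕ} {𝒳 : Fin n → QuantumSet.{u, v}}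
    {a : ∀ i, (𝒳 i).At} (c : Idx 𝒳 a → ℂ) :
    ∃ ζ : Functional 𝒳 a, ∀ κ, ζ (basisVec κ) = c κ := by
  classical
  let η : Idx 𝒳 a → Functional 𝒳 a := fun μ =>
    (MultilinearMap.mkPiAlgebra ℂ (Fin n) ℂ).compLinearMap fun i =>
      (innerSL ℂ ((𝒳 i).onb (a i) (μ i))).toLinearMap
  have hη : ∀ μ κ, η μ (basisVec κ) = if μ = κ then 1 else 0 := by
    intro μ κ
    have : η μ (basisVec κ) = ∏ i, if μ i = κ i then 1 else 0 := by
      simp only [η, MultilinearMap.compLinearMap_apply, MultilinearMap.mkPiAlgebra_apply]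
      exact Finset.prod_congr rfl fun i _ => by
        simpa using orthonormal_iff_ite.1 ((𝒳 i).onb (a i)).orthonormal (μ i) (κ i)
    rw [this]
    split_ifs with h
    · exact Finset.prod_eq_one fun i _ => by rw [h, if_pos rfl]
    · obtain ⟨i, hi⟩ := Function.ne_iff.1 h
      exact Finset.prod_eq_zero (Finset.mem_univ i) (if_neg hi)
  refine ⟨∑ μ, c μ • η μ, fun κ => ?_⟩
  rw [functional_sum_apply]
  simp [hη]

/-! ### Transitivity -/

section Transitivity

variable (X : QuantumSet.{u, v})

/-- Indices of the orthonormal basis of an atom. -/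
abbrev Ix (b : X.At) : Type := Fin (Module.finrank ℂ (X.H b))

/-- Indices of the orthonormal basis of the dual of an atom. -/
abbrev Coix (b : X.At) : Type := Fin (Module.finrank ℂ (X.dual.H b))

instance (b : X.At) : Nonempty (X.Coix b) := ⟨⟨0, Module.finrank_pos⟩⟩

/-- The context `x₃, x₃_*, x₂, x₂_*, x₁, x₁_*`. -/
abbrev ctx : Fin 6 → QuantumSet.{u, v} := ![X, X.dual, X, X.dual, X, X.dual]

variable {X}

/-- The atoms in the context, when each variable ranges over the same atom as its dual variable. -/
abbrev ctxAt (b₁ b₂ b₃ : X.At) : ∀ i, (X.ctx i).At :=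
  consAt b₃ (consAt (X := X.dual) b₃ (consAt b₂ (consAt (X := X.dual) b₂
    (consAt b₁ (consAt (X := X.dual) b₁ finZeroElim)))))

variable {b₁ b₂ b₃ : X.At}

/-- The indices of a basis vector in the context. -/
abbrev ctxIdx (k₀ : X.Ix b₃) (k₁ : X.Coix b₃) (k₂ : X.Ix b₂) (k₃ : X.Coix b₂) (k₄ : X.Ix b₁)
    (k₅ : X.Coix b₁) : Idx X.ctx (ctxAt b₁ b₂ b₃) :=
  consIdx k₀ (consIdx (X := X.dual) k₁ (consIdx k₂ (consIdx (X := X.dual) k₃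
    (consIdx k₄ (consIdx (X := X.dual) k₅ finZeroElim)))))

theorem forall_fin_six {P : Fin 6 → Prop} (h₀ : P 0) (h₁ : P 1) (h₂ : P 2) (h₃ : P 3) (h₄ : P 4)
    (h₅ : P 5) (i : Fin 6) : P i := by
  fin_cases i <;> assumption

theorem exists_ctxIdx (κ : Idx X.ctx (ctxAt b₁ b₂ b₃)) :
    ∃ k₀ k₁ k₂ k₃ k₄ k₅, κ = ctxIdx k₀ k₁ k₂ k₃ k₄ k₅ := by
  refine ⟨κ 0, κ 1, κ 2, κ 3, κ 4, κ 5, funext fun i => ?_⟩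
  fin_cases i <;> rfl

theorem mem_bend_four_three (R : BinRel X X) (π : Functional X.ctx (ctxAt b₁ b₂ b₃)) :
    π ∈ (Formula.atomic₂ (𝒳 := X.ctx) (bend R) 4 3 rfl rfl (by decide)).interp _ ↔
      ∀ k₀ k₁ k₂ k₅, ∃ r ∈ R b₁ b₂, ∀ k₃ k₄,
        π (basisVec (ctxIdx k₀ k₁ k₂ k₃ k₄ k₅)) = X.coonb b₂ k₃ (r (X.onb b₁ k₄)) := by
  refine (mem_atomic₂_bend_iff _ _ _ _ _).trans ⟨fun h k₀ k₁ k₂ k₅ => ?_, fun h κ => ?_⟩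
  -- The operator must be independent of `k₃` and `k₄`, so it is chosen at arbitrary indices in
  -- these places.
  · obtain ⟨l₃⟩ : Nonempty (X.Coix b₂) := inferInstance
    obtain ⟨l₄⟩ : Nonempty (X.Ix b₁) := inferInstance
    obtain ⟨r, hr, e⟩ := h (ctxIdx k₀ k₁ k₂ l₃ l₄ k₅)
    refine ⟨r, hr, fun k₃ k₄ => e (ctxIdx k₀ k₁ k₂ k₃ k₄ k₅) (forall_fin_six
      (fun _ _ => Eq.trans (b := k₀) rfl rfl) (fun _ _ => Eq.trans (b := k₁) rfl rfl)
      (fun _ _ => Eq.trans (b := k₂) rfl rfl) (fun _ h => absurd rfl h)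
      (fun h => absurd rfl h) (fun _ _ => Eq.trans (b := k₅) rfl rfl))⟩
  · obtain ⟨k₀, k₁, k₂, k₃, k₄, k₅, rfl⟩ := exists_ctxIdx κ
    obtain ⟨r, hr, e⟩ := h k₀ k₁ k₂ k₅
    refine ⟨r, hr, fun κ' h' => ?_⟩
    obtain ⟨l₀, l₁, l₂, l₃, l₄, l₅, rfl⟩ := exists_ctxIdx κ'
    obtain rfl : l₀ = k₀ := h' 0 (by decide) (by decide)
    obtain rfl : l₁ = k₁ := h' 1 (by decide) (by decide)
    obtain rfl : l₂ = k₂ := h' 2 (by decide) (by decide)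
    obtain rfl : l₅ = k₅ := h' 5 (by decide) (by decide)
    exact e l₃ l₄

theorem mem_bend_two_one (R : BinRel X X) (π : Functional X.ctx (ctxAt b₁ b₂ b₃)) :
    π ∈ (Formula.atomic₂ (𝒳 := X.ctx) (bend R) 2 1 rfl rfl (by decide)).interp _ ↔
      ∀ k₀ k₃ k₄ k₅, ∃ s ∈ R b₂ b₃, ∀ k₁ k₂,
        π (basisVec (ctxIdx k₀ k₁ k₂ k₃ k₄ k₅)) = X.coonb b₃ k₁ (s (X.onb b₂ k₂)) := by
  refine (mem_atomic₂_bend_iff _ _ _ _ _).trans ⟨fun h k₀ k₃ k₄ k₅ => ?_, fun h κ => ?_⟩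
  · obtain ⟨l₁⟩ : Nonempty (X.Coix b₃) := inferInstance
    obtain ⟨l₂⟩ : Nonempty (X.Ix b₂) := inferInstance
    obtain ⟨r, hr, e⟩ := h (ctxIdx k₀ l₁ l₂ k₃ k₄ k₅)
    refine ⟨r, hr, fun k₁ k₂ => e (ctxIdx k₀ k₁ k₂ k₃ k₄ k₅) (forall_fin_six
      (fun _ _ => Eq.trans (b := k₀) rfl rfl) (fun _ h => absurd rfl h)
      (fun h => absurd rfl h) (fun _ _ => Eq.trans (b := k₃) rfl rfl)
      (fun _ _ => Eq.trans (b := k₄) rfl rfl) (fun _ _ => Eq.trans (b := k₅) rfl rfl))⟩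
  · obtain ⟨k₀, k₁, k₂, k₃, k₄, k₅, rfl⟩ := exists_ctxIdx κ
    obtain ⟨r, hr, e⟩ := h k₀ k₃ k₄ k₅
    refine ⟨r, hr, fun κ' h' => ?_⟩
    obtain ⟨l₀, l₁, l₂, l₃, l₄, l₅, rfl⟩ := exists_ctxIdx κ'
    obtain rfl : l₀ = k₀ := h' 0 (by decide) (by decide)
    obtain rfl : l₃ = k₃ := h' 3 (by decide) (by decide)
    obtain rfl : l₄ = k₄ := h' 4 (by decide) (by decide)
    obtain rfl : l₅ = k₅ := h' 5 (by decide) (by decide)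
    exact e l₁ l₂

theorem mem_bendConj_five_zero (R : BinRel X X) (π : Functional X.ctx (ctxAt b₁ b₂ b₃)) :
    π ∈ (Formula.atomic₂ (𝒳 := X.ctx) (bendConj R) 5 0 rfl rfl (by decide)).interp _ ↔
      ∀ k₁ k₂ k₃ k₄, ∃ t ∈ R b₁ b₃, ∀ k₀ k₅, π (basisVec (ctxIdx k₀ k₁ k₂ k₃ k₄ k₅)) =
        X.coonb b₁ k₅ (ContinuousLinearMap.adjoint t (X.onb b₃ k₀)) := by
  refine (mem_atomic₂_bendConj_iff _ _ _ _ _).trans ⟨fun h k₁ k₂ k₃ k₄ => ?_, fun h κ => ?_⟩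
  · obtain ⟨l₀⟩ : Nonempty (X.Ix b₃) := inferInstance
    obtain ⟨l₅⟩ : Nonempty (X.Coix b₁) := inferInstance
    obtain ⟨t, ht, e⟩ := h (ctxIdx l₀ k₁ k₂ k₃ k₄ l₅)
    refine ⟨t, ht, fun k₀ k₅ => e (ctxIdx k₀ k₁ k₂ k₃ k₄ k₅) (forall_fin_six
      (fun _ h => absurd rfl h) (fun _ _ => Eq.trans (b := k₁) rfl rfl)
      (fun _ _ => Eq.trans (b := k₂) rfl rfl) (fun _ _ => Eq.trans (b := k₃) rfl rfl)
      (fun _ _ => Eq.trans (b := k₄) rfl rfl) (fun h => absurd rfl h))⟩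
  · obtain ⟨k₀, k₁, k₂, k₃, k₄, k₅, rfl⟩ := exists_ctxIdx κ
    obtain ⟨t, ht, e⟩ := h k₁ k₂ k₃ k₄
    refine ⟨t, ht, fun κ' h' => ?_⟩
    obtain ⟨l₀, l₁, l₂, l₃, l₄, l₅, rfl⟩ := exists_ctxIdx κ'
    obtain rfl : l₁ = k₁ := h' 1 (by decide) (by decide)
    obtain rfl : l₂ = k₂ := h' 2 (by decide) (by decide)
    obtain rfl : l₃ = k₃ := h' 3 (by decide) (by decide)
    obtain rfl : l₄ = k₄ := h' 4 (by decide) (by decide)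
    exact e l₀ l₅

theorem sum_ctxIdx (f : Idx X.ctx (ctxAt b₁ b₂ b₃) → ℂ) :
    ∑ κ, f κ = ∑ k₀, ∑ k₁, ∑ k₂, ∑ k₃, ∑ k₄, ∑ k₅, f (ctxIdx k₀ k₁ k₂ k₃ k₄ k₅) := by
  simp only [sum_consIdx, Fintype.sum_unique]
  rfl

/-- The contraction of a functional with the matrix coefficients of `r` and `s`. -/
def contract (r : X.H b₁ →L[ℂ] X.H b₂) (s : X.H b₂ →L[ℂ] X.H b₃)
    (π : Functional X.ctx (ctxAt b₁ b₂ b₃)) (k₀ : X.Ix b₃) (k₅ : X.Coix b₁) : ℂ :=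
  ∑ k₁, ∑ k₂, ∑ k₃, ∑ k₄, conj (X.coonb b₂ k₃ (r (X.onb b₁ k₄))) *
    (conj (X.coonb b₃ k₁ (s (X.onb b₂ k₂))) * π (basisVec (ctxIdx k₀ k₁ k₂ k₃ k₄ k₅)))

/-- The product of the three evaluations. -/
abbrev evals (b₁ b₂ b₃ : X.At) : Functional X.ctx (ctxAt b₁ b₂ b₃) :=
  diag b₃ (diag b₂ (diag b₁ unitFunctional))

theorem evals_basisVec (k₀ : X.Ix b₃) (k₁ : X.Coix b₃) (k₂ : X.Ix b₂) (k₃ : X.Coix b₂)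
    (k₄ : X.Ix b₁) (k₅ : X.Coix b₁) :
    evals b₁ b₂ b₃ (basisVec (ctxIdx k₀ k₁ k₂ k₃ k₄ k₅)) =
      X.coonb b₃ k₁ (X.onb b₃ k₀) * (X.coonb b₂ k₃ (X.onb b₂ k₂) *
        X.coonb b₁ k₅ (X.onb b₁ k₄)) := by
  refine (diag_basisVec _ _ _ _ _).trans (congrArg (_ * ·) ?_)
  refine (diag_basisVec _ _ _ _ _).trans (congrArg (_ * ·) ?_)
  exact (diag_basisVec _ _ _ _ _).trans (mul_one _)

/-- This is where composition appears. Parseval over `k₃` and `k₁` gives ⟨r e₄ | e₂⟩ and ⟨s e₂ |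
e₀⟩, and summing over the basis vectors e₂ gives ⟨s r e₄ | e₀⟩. The conjugated coefficients of r and
s are the reason for the adjoint, hence for [R]_* in the conclusion of the sentence. -/
theorem contract_evals (r : X.H b₁ →L[ℂ] X.H b₂) (s : X.H b₂ →L[ℂ] X.H b₃) (k₀ : X.Ix b₃)
    (k₅ : X.Coix b₁) :
    contract r s (evals b₁ b₂ b₃) k₀ k₅ =
      X.coonb b₁ k₅ (ContinuousLinearMap.adjoint (s ∘L r) (X.onb b₃ k₀)) := by
  have h : contract r s (evals b₁ b₂ b₃) k₀ k₅ = ∑ k₄, (∑ k₂,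
      (∑ k₃, conj (X.coonb b₂ k₃ (r (X.onb b₁ k₄))) * X.coonb b₂ k₃ (X.onb b₂ k₂)) *
        (∑ k₁, conj (X.coonb b₃ k₁ (s (X.onb b₂ k₂))) * X.coonb b₃ k₁ (X.onb b₃ k₀))) *
      X.coonb b₁ k₅ (X.onb b₁ k₄) := by
    simp only [Finset.sum_mul, Finset.mul_sum]
    rw [contract, Finset.sum_comm]
    conv_rhs => rw [Finset.sum_comm]
    refine Finset.sum_congr rfl fun k₂ _ => ?_
    conv_rhs => rw [Finset.sum_comm]
    refine Finset.sum_congr rfl fun k₁ _ => ?_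
    rw [Finset.sum_comm]
    refine Finset.sum_congr rfl fun k₄ _ => Finset.sum_congr rfl fun k₃ _ => ?_
    rw [evals_basisVec]
    ring
  rw [h]
  conv_rhs => rw [← (X.onb b₁).sum_repr' (ContinuousLinearMap.adjoint (s ∘L r) (X.onb b₃ k₀))]
  simp only [map_sum, map_smul, smul_eq_mul]
  refine Finset.sum_congr rfl fun k₄ _ => ?_
  congr 1
  refine (Finset.sum_congr rfl fun k₂ _ => congrArg₂ (· * ·) (sum_conj_onb_dual X b₂ _ _)
    (sum_conj_onb_dual X b₃ _ _)).trans ?_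
  rw [ContinuousLinearMap.adjoint_inner_right, ContinuousLinearMap.comp_apply,
    ← ContinuousLinearMap.adjoint_inner_right s, ← (X.onb b₂).sum_inner_mul_inner]
  simp only [ContinuousLinearMap.adjoint_inner_right]

/-- Take θ to be [r] ⊗ [s] times basis functionals in places 0 and 5. Its slices are multiples of r
or of s, so θ satisfies the premise, and functionals with the same projection onto the premise have
the same contractions. -/
theorem exists_innerFunctional_eq_contract {R : BinRel X X} {r : X.H b₁ →L[ℂ] X.H b₂}
    {s : X.H b₂ →L[ℂ] X.H b₃} (hr : r ∈ R b₁ b₂) (hs : s ∈ R b₂ b₃) (k₀ : X.Ix b₃)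
    (k₅ : X.Coix b₁) :
    ∃ θ : Functional X.ctx (ctxAt b₁ b₂ b₃),
      θ ∈ (Formula.and (Formula.atomic₂ (𝒳 := X.ctx) (bend R) 4 3 rfl rfl (by decide))
        (Formula.atomic₂ (𝒳 := X.ctx) (bend R) 2 1 rfl rfl (by decide))).interp _ ∧
      ∀ π, innerFunctional θ π = contract r s π k₀ k₅ := by
  let c (l₀ : X.Ix b₃) (l₁ : X.Coix b₃) (l₂ : X.Ix b₂) (l₃ : X.Coix b₂) (l₄ : X.Ix b₁)
    (l₅ : X.Coix b₁) : ℂ := (if l₀ = k₀ then 1 else 0) * (if l₅ = k₅ then 1 else 0) *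
      X.coonb b₂ l₃ (r (X.onb b₁ l₄)) * X.coonb b₃ l₁ (s (X.onb b₂ l₂))
  obtain ⟨θ, hθ'⟩ := exists_functional_of_coords
    fun κ : Idx X.ctx (ctxAt b₁ b₂ b₃) => c (κ 0) (κ 1) (κ 2) (κ 3) (κ 4) (κ 5)
  have hθ : ∀ l₀ l₁ l₂ l₃ l₄ l₅, θ (basisVec (ctxIdx l₀ l₁ l₂ l₃ l₄ l₅)) = c l₀ l₁ l₂ l₃ l₄ l₅ :=
    fun l₀ l₁ l₂ l₃ l₄ l₅ => hθ' _
  refine ⟨θ, ⟨(mem_bend_four_three R θ).2 fun l₀ l₁ l₂ l₅ => ?_,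
    (mem_bend_two_one R θ).2 fun l₀ l₃ l₄ l₅ => ?_⟩, fun π => ?_⟩
  · refine ⟨((if l₀ = k₀ then 1 else 0) * (if l₅ = k₅ then 1 else 0) *
      X.coonb b₃ l₁ (s (X.onb b₂ l₂)) : ℂ) • r, Submodule.smul_mem _ _ hr, fun l₃ l₄ => ?_⟩
    rw [hθ, smul_apply, map_smul, smul_eq_mul]
    ring
  · refine ⟨((if l₀ = k₀ then 1 else 0) * (if l₅ = k₅ then 1 else 0) *
      X.coonb b₂ l₃ (r (X.onb b₁ l₄)) : ℂ) • s, Submodule.smul_mem _ _ hs, fun l₁ l₂ => ?_⟩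
    rw [hθ, smul_apply, map_smul, smul_eq_mul]
  · rw [innerFunctional_eq, sum_ctxIdx, contract, Finset.sum_eq_single k₀]
    · refine Finset.sum_congr rfl fun l₁ _ => Finset.sum_congr rfl fun l₂ _ =>
        Finset.sum_congr rfl fun l₃ _ => Finset.sum_congr rfl fun l₄ _ => ?_
      rw [Finset.sum_eq_single k₅]
      · rw [hθ]
        simp only [c, if_true, one_mul, map_mul, mul_assoc]
      · intro l₅ _ h
        rw [hθ]
        simp [c, h]
      · exact fun h => absurd (Finset.mem_univ _) h
    · intro l₀ _ h
      simp [hθ, c, h]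
    · exact fun h => absurd (Finset.mem_univ _) h

/-- The slices of π in places 3, 4 and in places 1, 2 are matrices of operators in R, so the
reproducing kernels at (k₃, k₄) and (k₁, k₂) recover the entry of π. They do not depend on `k₀` and
`k₅`, so a whole slice is a single contraction. -/
theorem exists_contract_eq {R : BinRel X X} {π : Functional X.ctx (ctxAt b₁ b₂ b₃)}
    (hπ : π ∈ (Formula.and (Formula.atomic₂ (𝒳 := X.ctx) (bend R) 4 3 rfl rfl (by decide))
      (Formula.atomic₂ (𝒳 := X.ctx) (bend R) 2 1 rfl rfl (by decide))).interp _)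
    (k₁ : X.Coix b₃) (k₂ : X.Ix b₂) (k₃ : X.Coix b₂) (k₄ : X.Ix b₁) :
    ∃ r ∈ R b₁ b₂, ∃ s ∈ R b₂ b₃, ∀ k₀ k₅,
      π (basisVec (ctxIdx k₀ k₁ k₂ k₃ k₄ k₅)) = contract r s π k₀ k₅ := by
  let mat (b c : X.At) : (X.H b →L[ℂ] X.H c) →ₗ[ℂ] X.Coix c → X.Ix b → ℂ :=
    { toFun := fun r l k => X.coonb c l (r (X.onb b k))
      map_add' := fun r r' => by
        ext
        simp
      map_smul' := fun d r => by
        ext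
        simp }
  obtain ⟨_, ⟨r, hr, rfl⟩, hr'⟩ := ((R b₁ b₂).map (mat b₁ b₂)).exists_reproducing k₃ k₄
  obtain ⟨_, ⟨s, hs, rfl⟩, hs'⟩ := ((R b₂ b₃).map (mat b₂ b₃)).exists_reproducing k₁ k₂
  refine ⟨r, hr, s, hs, fun k₀ k₅ => ?_⟩
  have h₁ : ∀ l₃ l₄, π (basisVec (ctxIdx k₀ k₁ k₂ l₃ l₄ k₅)) = ∑ l₁, ∑ l₂,
      conj (X.coonb b₃ l₁ (s (X.onb b₂ l₂))) * π (basisVec (ctxIdx k₀ l₁ l₂ l₃ l₄ k₅)) := by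
    intro l₃ l₄
    refine hs' (fun l₁ l₂ => π (basisVec (ctxIdx k₀ l₁ l₂ l₃ l₄ k₅))) ?_
    obtain ⟨s', hs', e⟩ := (mem_bend_two_one R π).1 hπ.2 k₀ l₃ l₄ k₅
    exact ⟨s', hs', funext fun l₁ => funext fun l₂ => (e l₁ l₂).symm⟩
  have h₂ : π (basisVec (ctxIdx k₀ k₁ k₂ k₃ k₄ k₅)) = ∑ l₃, ∑ l₄,
      conj (X.coonb b₂ l₃ (r (X.onb b₁ l₄))) * π (basisVec (ctxIdx k₀ k₁ k₂ l₃ l₄ k₅)) := by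
    refine hr' (fun l₃ l₄ => π (basisVec (ctxIdx k₀ k₁ k₂ l₃ l₄ k₅))) ?_
    obtain ⟨r', hr', e⟩ := (mem_bend_four_three R π).1 hπ.1 k₀ k₁ k₂ k₅
    exact ⟨r', hr', funext fun l₃ => funext fun l₄ => (e l₃ l₄).symm⟩
  rw [h₂, contract]
  simp only [h₁, Finset.mul_sum]
  have h : ∀ F : X.Coix b₃ → X.Ix b₂ → X.Coix b₂ → X.Ix b₁ → ℂ,
      ∑ l₃, ∑ l₄, ∑ l₁, ∑ l₂, F l₁ l₂ l₃ l₄ = ∑ l₁, ∑ l₂, ∑ l₃, ∑ l₄, F l₁ l₂ l₃ l₄ := by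
    intro F
    simp only [← Fintype.sum_prod_type']
    exact (((Equiv.prodAssoc _ _ _).symm.trans ((Equiv.prodComm _ _).trans
      (Equiv.prodAssoc _ _ _))).trans (Equiv.refl _)).sum_comp (M := ℂ) _ |>.symm
  exact h _

theorem mem_imp_evals_iff (R : BinRel X X) :
    evals b₁ b₂ b₃ ∈ (Formula.imp (.and
        (Formula.atomic₂ (𝒳 := X.ctx) (bend R) 4 3 rfl rfl (by decide))
        (Formula.atomic₂ (𝒳 := X.ctx) (bend R) 2 1 rfl rfl (by decide)))
      (Formula.atomic₂ (𝒳 := X.ctx) (bendConj R) 5 0 rfl rfl (by decide))).interp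
        (ctxAt b₁ b₂ b₃) ↔
      ∀ r ∈ R b₁ b₂, ∀ s ∈ R b₂ b₃, s ∘L r ∈ R b₁ b₃ := by
  constructor
  · rw [mem_imp_iff]
    rintro ⟨π, -, hπ, h⟩ r hr s hs
    -- π is the projection of `evals` onto the premise, and contraction is an inner product with an
    -- element of the premise.
    have hc : ∀ k₀ k₅, contract r s (evals b₁ b₂ b₃) k₀ k₅ = contract r s π k₀ k₅ := by
      intro k₀ k₅
      obtain ⟨θ, hθ, e⟩ := exists_innerFunctional_eq_contract hr hs k₀ k₅
      rw [← e, ← e, ← sub_eq_zero, ← h θ hθ]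
      simp [innerFunctional_eq, mul_sub]
    choose t ht e using (mem_bendConj_five_zero R π).1 hπ
    -- The contraction is a combination of slices t^† of π; taking adjoints removes the conjugates
    -- from its coefficients.
    have : s ∘L r = ∑ k₁, ∑ k₂, ∑ k₃, ∑ k₄, (X.coonb b₂ k₃ (r (X.onb b₁ k₄)) *
        X.coonb b₃ k₁ (s (X.onb b₂ k₂))) • t k₁ k₂ k₃ k₄ := by
      refine ContinuousLinearMap.adjoint.injective (eq_of_coonb fun k₀ k₅ => ?_)
      rw [← contract_evals, hc, contract]
      simp only [map_sum, LinearIsometryEquiv.map_smulₛₗ, sum_apply, smul_apply, map_smul,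
        smul_eq_mul, map_mul, e, mul_assoc]
    rw [this]
    exact Submodule.sum_mem _ fun k₁ _ => Submodule.sum_mem _ fun k₂ _ =>
      Submodule.sum_mem _ fun k₃ _ => Submodule.sum_mem _ fun k₄ _ =>
        Submodule.smul_mem _ _ (ht k₁ k₂ k₃ k₄)
  · intro h
    rw [mem_imp_iff]
    obtain ⟨π, hπ, h'⟩ := exists_projection _ (evals b₁ b₂ b₃)
    refine ⟨π, hπ, (mem_bendConj_five_zero R π).2 fun k₁ k₂ k₃ k₄ => ?_, h'⟩
    obtain ⟨r, hr, s, hs, e⟩ := exists_contract_eq hπ k₁ k₂ k₃ k₄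
    refine ⟨s ∘L r, h r hr s hs, fun k₀ k₅ => ?_⟩
    obtain ⟨θ, hθ, e'⟩ := exists_innerFunctional_eq_contract hr hs k₀ k₅
    rw [e, ← contract_evals, ← e', ← e', eq_comm, ← sub_eq_zero, ← h' θ hθ]
    simp [innerFunctional_eq, mul_sub]

theorem transitivity_isTrue_iff (R : BinRel X X) :
    (transitivity R).IsTrue ↔
      ∀ b₁ b₂ b₃, ∀ r ∈ R b₁ b₂, ∀ s ∈ R b₂ b₃, s ∘L r ∈ R b₁ b₃ := by
  rw [isTrue_iff, transitivity]
  simp only [mem_allDiag_iff]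
  exact forall_congr' fun b₁ => forall_congr' fun b₂ => forall_congr' fun b₃ => mem_imp_evals_iff R

end Transitivity

/-! ### Operators on the direct sum of the atoms -/

section Operators

variable {X : QuantumSet.{u, v}}

theorem inc_apply_self (a : X.At) (y : X.H a) : X.inc a y a = y := by
  classical
  exact lp.single_apply_self (E := X.H) 2 a y

theorem inc_apply_of_ne {a b : X.At} (h : b ≠ a) (y : X.H a) : X.inc a y b = 0 := by
  classical
  exact lp.single_apply_ne (E := X.H) 2 a y h

theorem hasSum_inc (f : X.directSum) : HasSum (fun a => X.inc a (f a)) f := by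
  classical
  exact lp.hasSum_single (E := X.H) (p := 2) (by norm_num) f

/-- The component `inc_b^† T inc_a` of an operator. -/
def block (T : X.directSum →L[ℂ] X.directSum) (a b : X.At) : X.H a →L[ℂ] X.H b :=
  ContinuousLinearMap.adjoint (X.inc b) ∘L T ∘L X.inc a

theorem block_apply (T : X.directSum →L[ℂ] X.directSum) (a b : X.At) (x : X.H a) :
    block T a b x = T (X.inc a x) b :=
  adjoint_inc X b _

theorem mem_relOf_iff {V : Submodule ℂ (X.directSum →L[ℂ] X.directSum)} {a b : X.At}
    {r : X.H a →L[ℂ] X.H b} : r ∈ X.relOf V a b ↔ ∃ T ∈ V, r = block T a b := Iff.rfl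

/-- The operator `inc_b r inc_a^†`. -/
def unblock {a b : X.At} (r : X.H a →L[ℂ] X.H b) : X.directSum →L[ℂ] X.directSum :=
  X.inc b ∘L r ∘L ContinuousLinearMap.adjoint (X.inc a)

theorem unblock_apply {a b : X.At} (r : X.H a →L[ℂ] X.H b) (f : X.directSum) :
    unblock r f = X.inc b (r (f a)) := by
  simp [unblock, adjoint_inc]

theorem block_unblock {a b : X.At} (r : X.H a →L[ℂ] X.H b) : block (unblock r) a b = r := by
  ext x
  rw [block_apply, unblock_apply, inc_apply_self, inc_apply_self]

theorem block_unblock_of_ne {a b c d : X.At} (r : X.H a →L[ℂ] X.H b) (h : c ≠ a ∨ d ≠ b) :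
    block (unblock r) c d = 0 := by
  ext x
  rw [block_apply, unblock_apply]
  rcases h with h | h
  · simp [inc_apply_of_ne h.symm]
  · rw [inc_apply_of_ne h, zero_apply]

theorem star_unblock {a b : X.At} (r : X.H a →L[ℂ] X.H b) :
    star (unblock r) = unblock (ContinuousLinearMap.adjoint r) := by
  simp [unblock, ContinuousLinearMap.star_eq_adjoint, ContinuousLinearMap.adjoint_comp,
    ContinuousLinearMap.comp_assoc]

theorem block_star (T : X.directSum →L[ℂ] X.directSum) (a b : X.At) :
    block (star T) a b = ContinuousLinearMap.adjoint (block T b a) := by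
  simp [block, ContinuousLinearMap.star_eq_adjoint, ContinuousLinearMap.adjoint_comp,
    ContinuousLinearMap.comp_assoc]

theorem block_add (S T : X.directSum →L[ℂ] X.directSum) (a b : X.At) :
    block (S + T) a b = block S a b + block T a b := by
  ext x
  simp [block_apply]

theorem block_smul (c : ℂ) (T : X.directSum →L[ℂ] X.directSum) (a b : X.At) :
    block (c • T) a b = c • block T a b := by
  ext x
  simp [block_apply]

/-- Every vector is the sum of its components, and bounded operators preserve convergent sums. -/
theorem ext_block {S T : X.directSum →L[ℂ] X.directSum}
    (h : ∀ a b, block S a b = block T a b) : S = T := by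
  have h' : ∀ a x, S (X.inc a x) = T (X.inc a x) := fun a x => by
    ext b
    rw [← block_apply, h, block_apply]
  ext1 f
  refine (S.hasSum (hasSum_inc f)).unique ?_
  simpa only [h'] using T.hasSum (hasSum_inc f)

/-! ### The commutant of `ℓ^∞(X)` -/

theorem mem_ellInfty_iff {T : X.directSum →L[ℂ] X.directSum} :
    T ∈ X.ellInfty ↔ ∃ t : ∀ a, X.H a →L[ℂ] X.H a, ∀ f a, T f a = t a (f a) := Iff.rfl

theorem unblock_mem_ellInfty {a : X.At} (r : X.H a →L[ℂ] X.H a) : unblock r ∈ X.ellInfty := by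
  classical
  refine mem_ellInfty_iff.2 ⟨fun b => if h : a = b then h ▸ r else 0, fun f b => ?_⟩
  rw [unblock_apply]
  rcases eq_or_ne a b with rfl | h
  · simp [inc_apply_self]
  · simp [inc_apply_of_ne h.symm, h]

theorem isScalarBetween_of_ne {a b : X.At} (h : a ≠ b) {r : X.H a →L[ℂ] X.H b} :
    IsScalarBetween r ↔ r = 0 := by
  constructor
  · rintro ⟨d, hd⟩
    exact eq_of_coonb fun k l => by simp [hd, evalPair, h]
  · rintro rfl
    exact ⟨0, fun x φ => by simp⟩

theorem isScalarBetween_self {a : X.At} {r : X.H a →L[ℂ] X.H a} :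
    IsScalarBetween r ↔ ∃ d : ℂ, r = d • ContinuousLinearMap.id ℂ _ := by
  refine exists_congr fun d => ⟨fun h => eq_of_coonb fun k l => ?_, ?_⟩
  · rw [h, evalPair_self]
    simp
  · rintro rfl x φ
    simp [evalPair_self]

theorem mem_commutant_ellInfty_iff {T : X.directSum →L[ℂ] X.directSum} :
    T ∈ X.ellInfty.commutant ↔ ∀ a b, IsScalarBetween (block T a b) := by
  rw [VonNeumannAlgebra.mem_commutant_iff]
  constructor
  · intro h a b
    have hc : ∀ (c : X.At) (r : X.H c →L[ℂ] X.H c) (f : X.directSum),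
        X.inc c (r (T f c)) = T (X.inc c (r (f c))) := fun c r f => by
      rw [← unblock_apply, ← unblock_apply]
      exact congrArg (fun S : X.directSum →L[ℂ] X.directSum => S f) (h _ (unblock_mem_ellInfty r))
    rcases eq_or_ne a b with rfl | hab
    · rw [isScalarBetween_self]
      obtain ⟨e, he⟩ := exists_ne (0 : X.H a)
      have he' : (inner ℂ e e : ℂ) ≠ 0 := inner_self_ne_zero.2 he
      -- Commuting with the rank-one operator y ↦ ⟨e | y⟩ x and evaluating at e gives ⟨e | t e⟩ x =
      -- ⟨e | e⟩ t x for the diagonal block t.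
      refine ⟨inner ℂ e (block T a a e) / inner ℂ e e, ?_⟩
      ext x
      have := congrArg (fun f : X.directSum => f a)
        (hc a ((innerSL ℂ e).smulRight x) (X.inc a e))
      rw [inc_apply_self, inc_apply_self, ← block_apply, ← block_apply] at this
      simp only [ContinuousLinearMap.smulRight_apply, innerSL_apply_apply, map_smul] at this
      simp only [smul_apply, ContinuousLinearMap.id_apply]
      rw [div_eq_inv_mul, mul_smul, this, inv_smul_smul₀ he']
    · rw [isScalarBetween_of_ne hab]
      ext x
      -- Commuting with the projection onto atom `b` kills the off-diagonal block.
      have := congrArg (fun f : X.directSum => f b)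
        (hc b (ContinuousLinearMap.id ℂ _) (X.inc a x))
      rw [block_apply]
      simpa [inc_apply_self, inc_apply_of_ne hab.symm] using this
  · rintro h S ⟨s, hs⟩
    have hS : ∀ a x, S (X.inc a x) = X.inc a (s a x) := fun a x => by
      ext b
      rw [hs]
      rcases eq_or_ne b a with rfl | hb
      · rw [inc_apply_self, inc_apply_self]
      · rw [inc_apply_of_ne hb, inc_apply_of_ne hb, map_zero]
    refine ext_block fun a b => ?_
    ext x
    have h₁ : block (S * T) a b x = s b (block T a b x) := by
      rw [block_apply, block_apply]
      exact hs _ _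
    have h₂ : block (T * S) a b x = block T a b (s a x) := by
      rw [block_apply, block_apply, ← hS]
      rfl
    rw [h₁, h₂]
    rcases eq_or_ne a b with rfl | hab
    · obtain ⟨d, hd⟩ := isScalarBetween_self.1 (h a a)
      simp [hd]
    · simp [(isScalarBetween_of_ne hab).1 (h a b)]

/-! ### Ultraweak approximation -/

/-- The projection onto the span of finitely many atoms. -/
def proj (F : Finset X.At) : X.directSum →L[ℂ] X.directSum :=
  ∑ a ∈ F, unblock (ContinuousLinearMap.id ℂ (X.H a))

theorem proj_apply (F : Finset X.At) (f : X.directSum) :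
    proj F f = ∑ a ∈ F, X.inc a (f a) := by
  simp [proj, sum_apply, unblock_apply]

theorem tendsto_proj (f : X.directSum) :
    Filter.Tendsto (fun F => proj F f) Filter.atTop (𝓝 f) := by
  simp only [proj_apply]
  exact hasSum_inc f

theorem inner_proj_right (F : Finset X.At) (f g : X.directSum) :
    inner ℂ f (proj F g) = inner ℂ (proj F f) g := by
  have : star (proj F : X.directSum →L[ℂ] X.directSum) = proj F := by
    have hid : ∀ a : X.At, ContinuousLinearMap.adjoint (ContinuousLinearMap.id ℂ (X.H a)) =
        ContinuousLinearMap.id ℂ _ := fun a => star_one (X.H a →L[ℂ] X.H a)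
    simp [proj, star_sum, star_unblock, hid]
  conv_rhs => rw [← this, ContinuousLinearMap.star_eq_adjoint,
    ContinuousLinearMap.adjoint_inner_left]

theorem proj_proj (F : Finset X.At) (f : X.directSum) : proj F (proj F f) = proj F f := by
  classical
  conv_lhs => rw [proj_apply]
  rw [proj_apply]
  refine Finset.sum_congr rfl fun a ha => ?_
  congr 1
  rw [lp.coeFn_sum, Finset.sum_apply, Finset.sum_eq_single a]
  · rw [inc_apply_self]
  · exact fun b _ hb => inc_apply_of_ne hb.symm _
  · exact fun h => absurd ha h

theorem norm_proj_le (F : Finset X.At) (f : X.directSum) : ‖proj F f‖ ≤ ‖f‖ := by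
  rcases eq_or_ne ‖proj F f‖ 0 with h | h
  · rw [h]
    exact norm_nonneg _
  · have : ‖proj F f‖ * ‖proj F f‖ ≤ ‖f‖ * ‖proj F f‖ := by
      rw [← inner_self_eq_norm_mul_norm (𝕜 := ℂ), ← inner_proj_right, proj_proj]
      exact re_inner_le_norm f _
    exact le_of_mul_le_mul_right this (lt_of_le_of_ne (norm_nonneg _) h.symm)

theorem summable_norm_mul_norm {H : Type*} [NormedAddCommGroup H] (x y : lp (fun _ : ℕ => H) 2) :
    Summable fun k => ‖x k‖ * ‖y k‖ := by
  have h : ∀ z : lp (fun _ : ℕ => H) 2, Summable fun k => ‖z k‖ ^ 2 := fun z => by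
    simpa using (lp.memℓp z).summable (by norm_num)
  refine Summable.of_nonneg_of_le (fun k => by positivity) (fun k => ?_) ((h x).add (h y))
  nlinarith [sq_nonneg (‖x k‖ - ‖y k‖), sq_nonneg (‖x k‖ + ‖y k‖)]

/-- The projections converge strongly to the identity, so each term of an ultraweak functional
converges. They are contractions, so ‖T‖ ‖x k‖ ‖y k‖ is a summable bound. -/
theorem tendsto_proj_mul_mul_proj (T : X.directSum →L[ℂ] X.directSum) :
    Filter.Tendsto (fun F : Finset X.At => proj F * T * proj F) Filter.atTop
      (@nhds _ (ultraweakTopology X.directSum) T) := by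
  simp only [nhds_iInf, Filter.tendsto_iInf, nhds_induced,
    Filter.tendsto_comap_iff]
  intro x y
  have h : ∀ F k, inner ℂ (x k) ((proj F * T * proj F) (y k)) =
      inner ℂ (proj F (x k)) (T (proj F (y k))) := fun F k =>
    inner_proj_right F _ _
  refine tendsto_tsum_of_dominated_convergence
    (bound := fun k => ‖T‖ * (‖x k‖ * ‖y k‖)) ((summable_norm_mul_norm x y).mul_left _) ?_ ?_
  · intro k
    simp only [h]
    exact (tendsto_proj (x k)).inner ((T.continuous.tendsto _).comp (tendsto_proj (y k)))
  · refine Filter.Eventually.of_forall fun F k => ?_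
    rw [h]
    calc _ ≤ ‖proj F (x k)‖ * ‖T (proj F (y k))‖ := norm_inner_le_norm _ _
      _ ≤ ‖x k‖ * (‖T‖ * ‖y k‖) := by
        gcongr
        · exact norm_proj_le _ _
        · exact (T.le_opNorm _).trans (by gcongr; exact norm_proj_le _ _)
      _ = _ := by ring

theorem continuous_ultraweak_inner (f g : X.directSum) :
    Continuous[ultraweakTopology X.directSum, inferInstance]
      fun T : X.directSum →L[ℂ] X.directSum => (inner ℂ f (T g) : ℂ) := by
  classical
  let x : lp (fun _ : ℕ => X.directSum) 2 := lp.single 2 0 f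
  let y : lp (fun _ : ℕ => X.directSum) 2 := lp.single 2 0 g
  have h : (fun T : X.directSum →L[ℂ] X.directSum => (inner ℂ f (T g) : ℂ)) =
      fun T => ∑' k, inner ℂ (x k) (T (y k)) := by
    funext T
    rw [tsum_eq_single 0 fun k hk => by simp [x, hk]]
    simp [x, y]
  rw [h]
  exact continuous_iInf_dom (i := x) (continuous_iInf_dom (i := y) continuous_induced_dom)

/-! ### The correspondence -/

/-- The projections onto atoms lie in the commutant, hence in `V`. The block is also a block of some
`S` in `V`, and compressing `S` by two projections stays in the algebra `V`. -/
theorem unblock_block_mem {V : Submodule ℂ (X.directSum →L[ℂ] X.directSum)}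
    (hV : IsQuantumPreorder X.ellInfty V) {T : X.directSum →L[ℂ] X.directSum} {a b : X.At}
    (h : block T a b ∈ X.relOf V a b) : unblock (block T a b) ∈ V := by
  have hp : ∀ c : X.At, unblock (ContinuousLinearMap.id ℂ (X.H c)) ∈ V := fun c => by
    refine hV.commutant_subset _ (mem_commutant_ellInfty_iff.2 fun a b => ?_)
    rcases eq_or_ne a b with rfl | hab
    · rw [isScalarBetween_self]
      rcases eq_or_ne a c with rfl | hac
      · exact ⟨1, by rw [block_unblock, one_smul]⟩
      · exact ⟨0, by rw [block_unblock_of_ne _ (Or.inl hac), zero_smul]⟩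
    · rw [isScalarBetween_of_ne hab]
      refine block_unblock_of_ne _ ?_
      by_contra! h
      exact hab (h.1.trans h.2.symm)
  obtain ⟨S, hS, e⟩ := mem_relOf_iff.1 h
  have : unblock (block T a b) = unblock (ContinuousLinearMap.id ℂ (X.H b)) * (S *
      unblock (ContinuousLinearMap.id ℂ (X.H a))) := by
    rw [e]
    ext1 f
    simp [unblock_apply, block_apply]
  rw [this]
  exact hV.mul_mem _ (hp b) _ (hV.mul_mem _ hS _ (hp a))

theorem proj_mul_mul_proj (T : X.directSum →L[ℂ] X.directSum) (F : Finset X.At) :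
    proj F * T * proj F = ∑ b ∈ F, ∑ a ∈ F, unblock (block T a b) := by
  rw [proj, Finset.sum_mul, Finset.sum_mul_sum]
  refine Finset.sum_congr rfl fun b _ => Finset.sum_congr rfl fun a _ => ?_
  ext1 f
  simp [unblock_apply, block_apply]

/-- A quantum preorder on `ℓ^∞(X)` consists of the operators with components in its relation. -/
theorem IsQuantumPreorder.mem_iff {V : Submodule ℂ (X.directSum →L[ℂ] X.directSum)}
    (hV : IsQuantumPreorder X.ellInfty V) (T : X.directSum →L[ℂ] X.directSum) :
    T ∈ V ↔ ∀ a b, block T a b ∈ X.relOf V a b := by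
  refine ⟨fun h a b => ⟨T, h, rfl⟩, fun h => ?_⟩
  refine @IsClosed.mem_of_tendsto _ (ultraweakTopology X.directSum) _ _ _ _ _ _ hV.isClosed
    (tendsto_proj_mul_mul_proj T) (Filter.Eventually.of_forall fun F => ?_)
  rw [proj_mul_mul_proj]
  exact Submodule.sum_mem _ fun b _ => Submodule.sum_mem _ fun a _ => unblock_block_mem hV (h a b)

/-- The operators all of whose components belong to `R`. -/
def opsOf (R : BinRel X X) : Submodule ℂ (X.directSum →L[ℂ] X.directSum) where
  carrier := {T | ∀ a b, block T a b ∈ R a b}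
  zero_mem' a b := by
    convert zero_mem (R a b)
    ext
    simp [block_apply]
  add_mem' hS hT a b := by
    rw [block_add]
    exact add_mem (hS a b) (hT a b)
  smul_mem' c T hT a b := by
    rw [block_smul]
    exact Submodule.smul_mem _ c (hT a b)

theorem unblock_mem_opsOf {R : BinRel X X} {a b : X.At} {r : X.H a →L[ℂ] X.H b} (hr : r ∈ R a b) :
    unblock r ∈ opsOf R := by
  intro c d
  by_cases h : c = a ∧ d = b
  · obtain ⟨rfl, rfl⟩ := h
    rwa [block_unblock]
  · rw [block_unblock_of_ne r (by tauto)]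
    exact zero_mem _

theorem relOf_opsOf (R : BinRel X X) : X.relOf (opsOf R) = R := by
  funext a b
  ext r
  constructor
  · rintro ⟨T, hT, rfl⟩
    exact hT a b
  · exact fun hr => ⟨unblock r, unblock_mem_opsOf hr, (block_unblock r).symm⟩

/-- The matrix coefficients of an operator between atoms. -/
def coeffs (a b : X.At) : (X.H a →L[ℂ] X.H b) →ₗ[ℂ] X.Ix a × X.Ix b → ℂ where
  toFun r k := inner ℂ (X.onb b k.2) (r (X.onb a k.1))
  map_add' r s := by
    ext
    simp
  map_smul' c r := by
    ext
    simp

theorem coeffs_injective (a b : X.At) : Function.Injective (coeffs a b) := by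
  intro r s h
  refine ContinuousLinearMap.coe_injective ((X.onb a).toBasis.ext fun k => ?_)
  rw [OrthonormalBasis.coe_toBasis]
  refine (X.onb b).repr.injective (PiLp.ext fun l => ?_)
  rw [OrthonormalBasis.repr_apply_apply, OrthonormalBasis.repr_apply_apply]
  exact congrFun h (k, l)

theorem coeffs_block (T : X.directSum →L[ℂ] X.directSum) (a b : X.At) (k : X.Ix a × X.Ix b) :
    coeffs a b (block T a b) k = inner ℂ (X.inc b (X.onb b k.2)) (T (X.inc a (X.onb a k.1))) :=
  ContinuousLinearMap.adjoint_inner_right (X.inc b) (X.onb b k.2) (T (X.inc a (X.onb a k.1)))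

theorem isClosed_map_coeffs {a b : X.At} (W : Submodule ℂ (X.H a →L[ℂ] X.H b)) :
    IsClosed (W.map (coeffs a b) : Set (X.Ix a × X.Ix b → ℂ)) :=
  Submodule.closed_of_finiteDimensional _

theorem mem_iff_coeffs_mem {a b : X.At} (W : Submodule ℂ (X.H a →L[ℂ] X.H b))
    (r : X.H a →L[ℂ] X.H b) : r ∈ W ↔ coeffs a b r ∈ W.map (coeffs a b) :=
  ((coeffs_injective a b).mem_set_image (s := (W : Set _))).symm

/-- Each block has finitely many matrix coefficients, all ultraweakly continuous in the operator,
and subspaces of finite-dimensional spaces are closed. -/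
theorem isClosed_opsOf (R : BinRel X X) :
    IsClosed[ultraweakTopology X.directSum] (opsOf R : Set (X.directSum →L[ℂ] X.directSum)) := by
  have : (opsOf R : Set (X.directSum →L[ℂ] X.directSum)) = ⋂ a, ⋂ b,
      (fun T => coeffs a b (block T a b)) ⁻¹' ((R a b).map (coeffs a b) : Set _) := by
    ext T
    simp only [Set.mem_iInter, Set.mem_preimage, SetLike.mem_coe, ← mem_iff_coeffs_mem]
    rfl
  rw [this]
  let _ := ultraweakTopology X.directSum
  refine isClosed_iInter fun a => isClosed_iInter fun b =>
    (isClosed_map_coeffs (R a b)).preimage (continuous_pi fun k => ?_)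
  simp only [coeffs_block]
  exact continuous_ultraweak_inner _ _

/-- A block of S T is a possibly infinite sum over the intermediate atoms. Cutting it off with `proj
F` gives finite sums of compositions, which lie in R; they converge to the block, and R(a, b) is
closed. -/
theorem mul_mem_opsOf {R : BinRel X X}
    (hR : ∀ b₁ b₂ b₃, ∀ r ∈ R b₁ b₂, ∀ s ∈ R b₂ b₃, s ∘L r ∈ R b₁ b₃)
    {S T : X.directSum →L[ℂ] X.directSum} (hS : S ∈ opsOf R) (hT : T ∈ opsOf R) :
    S * T ∈ opsOf R := by
  intro a b
  rw [mem_iff_coeffs_mem]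
  have h : Filter.Tendsto (fun F : Finset X.At => coeffs a b (block (S * proj F * T) a b))
      Filter.atTop (𝓝 (coeffs a b (block (S * T) a b))) := by
    refine tendsto_pi_nhds.2 fun k => ?_
    simp only [coeffs_block]
    exact tendsto_const_nhds.inner ((S.continuous.tendsto _).comp (tendsto_proj _))
  refine (isClosed_map_coeffs (R a b)).mem_of_tendsto h (Filter.Eventually.of_forall fun F => ?_)
  refine (mem_iff_coeffs_mem (R a b) _).1 ?_
  have : block (S * proj F * T) a b = ∑ c ∈ F, block S c b ∘L block T a c := by
    ext x
    rw [block_apply, sum_apply]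
    change S (proj F (T (X.inc a x))) b = _
    rw [proj_apply, map_sum, lp.coeFn_sum, Finset.sum_apply]
    exact Finset.sum_congr rfl fun c _ => by
      rw [ContinuousLinearMap.comp_apply, block_apply, block_apply]
  rw [this]
  exact Submodule.sum_mem _ fun c _ => hR a c b _ (hT a c) _ (hS c b)

theorem isQuantumPreorder_opsOf {R : BinRel X X}
    (h : ∀ b, ContinuousLinearMap.id ℂ (X.H b) ∈ R b b)
    (h' : ∀ b₁ b₂ b₃, ∀ r ∈ R b₁ b₂, ∀ s ∈ R b₂ b₃, s ∘L r ∈ R b₁ b₃) :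
    IsQuantumPreorder X.ellInfty (opsOf R) where
  isClosed := isClosed_opsOf R
  mul_mem _ hS _ hT := mul_mem_opsOf h' hS hT
  commutant_subset T hT a b := by
    have := mem_commutant_ellInfty_iff.1 hT a b
    rcases eq_or_ne a b with rfl | hab
    · obtain ⟨d, hd⟩ := isScalarBetween_self.1 this
      rw [hd]
      exact Submodule.smul_mem _ _ (h a)
    · rw [(isScalarBetween_of_ne hab).1 this]
      exact zero_mem _

theorem id_mem_relOf {V : Submodule ℂ (X.directSum →L[ℂ] X.directSum)}
    (hV : IsQuantumPreorder X.ellInfty V) (b : X.At) :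
    ContinuousLinearMap.id ℂ (X.H b) ∈ X.relOf V b b :=
  ⟨1, hV.commutant_subset _ (one_mem X.ellInfty.commutant.toStarSubalgebra), by
    ext x
    exact ((block_apply 1 b b x).trans (inc_apply_self b x)).symm⟩

theorem comp_mem_relOf {V : Submodule ℂ (X.directSum →L[ℂ] X.directSum)}
    (hV : IsQuantumPreorder X.ellInfty V) {b₁ b₂ b₃ : X.At} {r : X.H b₁ →L[ℂ] X.H b₂}
    (hr : r ∈ X.relOf V b₁ b₂) {s : X.H b₂ →L[ℂ] X.H b₃} (hs : s ∈ X.relOf V b₂ b₃) :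
    s ∘L r ∈ X.relOf V b₁ b₃ := by
  have hr' := unblock_block_mem hV (T := unblock r) (by rwa [block_unblock])
  have hs' := unblock_block_mem hV (T := unblock s) (by rwa [block_unblock])
  rw [block_unblock] at hr' hs'
  refine ⟨_, hV.mul_mem _ hs' _ hr', ?_⟩
  ext x
  refine Eq.trans ?_ (block_apply _ _ _ _).symm
  simp [unblock_apply, inc_apply_self]

theorem relOf_injOn : Set.InjOn X.relOf {V | IsQuantumPreorder X.ellInfty V} := by
  intro V hV W hW h
  ext T
  rw [IsQuantumPreorder.mem_iff hV, IsQuantumPreorder.mem_iff hW, h]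

/-- Forward, antisymmetry is applied to a single block extended by zero. Backward, the blocks of T^†
are the adjoints of the blocks of T, and scalar blocks mean membership in the commutant. -/
theorem isQuantumPartialOrder_iff {V : Submodule ℂ (X.directSum →L[ℂ] X.directSum)} :
    IsQuantumPartialOrder X.ellInfty V ↔ IsQuantumPreorder X.ellInfty V ∧
      ∀ b c, ∀ r ∈ X.relOf V b c, ContinuousLinearMap.adjoint r ∈ X.relOf V c b →
        IsScalarBetween r := by
  constructor
  · intro hV
    refine ⟨hV.toIsQuantumPreorder, fun b c r hr hr' => ?_⟩
    have h := unblock_block_mem hV.toIsQuantumPreorder (T := unblock r) (by rwa [block_unblock])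
    have h' := unblock_block_mem hV.toIsQuantumPreorder
      (T := unblock (ContinuousLinearMap.adjoint r)) (by rwa [block_unblock])
    rw [block_unblock] at h h'
    rw [← star_unblock] at h'
    rw [← block_unblock r]
    exact mem_commutant_ellInfty_iff.1 (hV.antisymm _ h h') b c
  · rintro ⟨hV, h⟩
    refine ⟨hV, fun T hT hT' => mem_commutant_ellInfty_iff.2 fun a b => h a b _ ⟨T, hT, rfl⟩ ?_⟩
    rw [← block_star]
    exact ⟨_, hT', rfl⟩

end Operators

end QuantumSet

end

theorem mainTheorem6 (X : QuantumSet.{u, v}) :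
    Set.BijOn X.relOf
        {V | IsQuantumPreorder X.ellInfty V}
        {R | (QuantumSet.reflexivity R).IsTrue ∧ (QuantumSet.transitivity R).IsTrue} ∧
      Set.BijOn X.relOf
        {V | IsQuantumPartialOrder X.ellInfty V}
        {R | (QuantumSet.reflexivity R).IsTrue ∧ (QuantumSet.transitivity R).IsTrue ∧
          (QuantumSet.antisymmetry R).IsTrue} := by
  simp only [QuantumSet.reflexivity_isTrue_iff, QuantumSet.transitivity_isTrue_iff,
    QuantumSet.antisymmetry_isTrue_iff, QuantumSet.isQuantumPartialOrder_iff]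
  refine ⟨⟨fun V hV => ⟨QuantumSet.id_mem_relOf hV, fun _ _ _ _ hr _ hs =>
      QuantumSet.comp_mem_relOf hV hr hs⟩, QuantumSet.relOf_injOn, fun R hR =>
      ⟨QuantumSet.opsOf R, QuantumSet.isQuantumPreorder_opsOf hR.1 hR.2,
        QuantumSet.relOf_opsOf R⟩⟩,
    ⟨fun V hV => ⟨QuantumSet.id_mem_relOf hV.1, fun _ _ _ _ hr _ hs =>
      QuantumSet.comp_mem_relOf hV.1 hr hs, hV.2⟩,
      QuantumSet.relOf_injOn.mono fun V hV => hV.1, fun R hR =>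
      ⟨QuantumSet.opsOf R, ⟨QuantumSet.isQuantumPreorder_opsOf hR.1 hR.2.1, ?_⟩,
        QuantumSet.relOf_opsOf R⟩⟩⟩
  rw [QuantumSet.relOf_opsOf]
  exact hR.2.2
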